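/- **Setting.** Write $\langle v\rangle=(1+|v|^2)^{1/2}$ for $v\in\mathbb R^3$ and $\hat g(\eta)=(2\pi)^{-3/2}\int_{\mathbb R^3}e^{-iv\cdot\eta}g(v)\,dv$. For $\sigma\ge 0$ and $M\in\mathbb N$ let $\|f\|_{H^\sigma_M}=\sum_{|a|\le M}\|\langle\nabla\rangle^\sigma(v^a f)\|_{L^2(\mathbb R^3)}$, where $\langle\nabla\rangle^\sigma$ is the Fourier multiplier with symbol $\langle\eta\rangle^\sigma$. For a real potential $W\in L^1(\mathbb R^3)$ and a function $f^0:\mathbb R^3\to\mathbb R$ put $$\mathcal L(\xi,k)=-\int_0^\infty e^{\bar\xi t}\,\widehat{f^0}(kt)\,\widehat W(k)\,|k|^2\,t\,dt .$$ The pair $W$, $f^0$ satisfies the *linear stability condition* **(L)** if there are constants $C_0,\kappa>0$, $\bar\sigma>3/2$ and an integer $M>3/2$ such that $\|f^0\|_{H^{\bar\sigma}_M}\le C_0$, the integral defining $\mathcal L(\xi,k)$ converges absolutely for all $\xi\in\mathbb C$ with $\operatorname{Re}\xi\le0$ and all $k\in\mathbb R^3$, and $$\inf_{\operatorname{Re}\xi\le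 0}\ \inf_{k\in\mathbb R^3}|\mathcal L(\xi,k)-1|\ge\kappa .$$ **Proposition.** Let $f^0:\mathbb R^3\to\mathbb R$ be continuous, strictly positive and radially symmetric, with $f^0\in H^{3/2+\delta}_2$ for some $\delta>0$, and suppose that there are constants $C,R$ such that for almost every $v$ with $|v|\ge R$ the function $f^0$ is differentiable at $v$ and $|f^0(v)|+|\nabla f^0(v)|\le C\langle v\rangle^{-4}$. Then: 1. For every $\alpha>0$, if $W\in L^1(\mathbb R^3)$ is the screened Coulomb potential, $\widehat W(k)=\dfrac1{\alpha+|k|^2}$ for all $k$, then $W$ and $f^0$ satisfy **(L)**. 2. The same holds for every $\alpha>0$ if $W\in L^1(\mathbb R^3)$ is normalized instead as the fundamental solution of $-\Delta\phi+\alpha\phi=\rho$, that is, $-\Delta W+\alpha W=\delta_0$ in the sense of distributions. 3. More generally, $W$ and $f^0$ satisfy **(L)** for every real $W\in L^1(\mathbb R^3)$ for which $\widehat W$ is real-valued and $0\le\widehat W(k)\le C_W\langle k\rangle^{-2}$ for all $k$, with some constant $C_W$. The constants in **(L)** may depend on $W$ (in particular on $\alpha$) and on $f^0$. -/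

import Mathlib

open MeasureTheory Set
open scoped ENNReal ContDiff FourierTransform Gradient InnerProductSpace ComplexConjugate

noncomputable section

namespace LandauDamping

/-- Euclidean three-space. -/
abbrev R3 : Type := EuclideanSpace ℝ (Fin 3)

/-- The Japanese bracket `⟨v⟩ = (1 + |v|^2)^(1/2)`. -/
def jap (v : R3) : ℝ := Real.sqrt (1 + ‖v‖ ^ 2)

/-- The unitary Fourier transform `ĝ(η) = (2π)^(-3/2) ∫ e^{-i v·η} g(v) dv` of an integrable
function `g`. -/
def hat (g : R3 → ℝ) (η : R3) : ℂ :=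
  (((2 * Real.pi) ^ (-(3 / 2) : ℝ) : ℝ) : ℂ) *
    ∫ v : R3, Complex.exp (-(Complex.I * ((inner ℝ v η : ℝ) : ℂ))) * ((g v : ℝ) : ℂ)

/-- The function `v ↦ v^a f(v)` for a multi-index `a`, as a complex-valued function. -/
def monomialMul (a : Fin 3 → ℕ) (f : R3 → ℝ) (v : R3) : ℂ :=
  (((∏ i, v i ^ a i) * f v : ℝ) : ℂ)

/-- The multi-indices `a ∈ ℕ^3` with `|a| ≤ M`. -/
def multiIndices (M : ℕ) : Finset (Fin 3 → ℕ) :=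
  (Fintype.piFinset fun _ : Fin 3 => Finset.range (M + 1)).filter fun a => ∑ i, a i ≤ M

open Classical in
/-- The Sobolev norm `‖⟨∇⟩^σ g‖_{L²}` for `σ ≥ 0`, with value `∞` if `g` is not in `L²` or not in
`H^σ`. It is computed by Plancherel. Mathlib's `L²` Fourier transform `𝓕` has the kernel
`e^{-2πi v·ξ}`, so that `⟨∇⟩^σ` is multiplication by `⟨2πξ⟩^σ`; as the transform is unitary, this is
exactly the norm that the kernel `(2π)^(-3/2) e^{-i v·η}` gives with the multiplier `⟨η⟩^σ`. -/
def sobolevNorm (σ : ℝ) (g : R3 → ℂ) : ℝ≥0∞ :=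
  if h : MemLp g 2 (volume : Measure R3) then
    eLpNorm (fun ξ : R3 => ((jap ((2 * Real.pi) • ξ) ^ σ : ℝ) : ℂ) *
      (𝓕 (h.toLp g : Lp (α := R3) ℂ 2) : Lp (α := R3) ℂ 2) ξ) 2 volume
  else ∞

/-- The weighted Sobolev norm `‖f‖_{H^σ_M} = ∑_{|a| ≤ M} ‖⟨∇⟩^σ (v^a f)‖_{L²}`. -/
def weightedSobolevNorm (σ : ℝ) (M : ℕ) (f : R3 → ℝ) : ℝ≥0∞ :=
  ∑ a ∈ multiIndices M, sobolevNorm σ (monomialMul a f)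

/-- The integrand `e^{ξ̄ t} f̂⁰(kt) Ŵ(k) |k|² t`. -/
def laplaceIntegrand (W f0 : R3 → ℝ) (ξ : ℂ) (k : R3) (t : ℝ) : ℂ :=
  Complex.exp (conj ξ * (t : ℂ)) * hat f0 (t • k) * hat W k * ((‖k‖ ^ 2 * t : ℝ) : ℂ)

/-- `𝓛(ξ,k) = -∫_0^∞ e^{ξ̄ t} f̂⁰(kt) Ŵ(k) |k|² t dt`. -/
def dispersion (W f0 : R3 → ℝ) (ξ : ℂ) (k : R3) : ℂ :=
  -∫ t in Ioi (0 : ℝ), laplaceIntegrand W f0 ξ k t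

/-- The linear stability condition (L) for the interaction `W` and the homogeneous equilibrium
`f0`. The integral that defines `𝓛(ξ,k)` is required to converge absolutely. -/
def StabilityL (W f0 : R3 → ℝ) : Prop :=
  ∃ (C0 κ σbar : ℝ) (M : ℕ), 0 < C0 ∧ 0 < κ ∧ 3 / 2 < σbar ∧ (3 / 2 : ℝ) < (M : ℝ) ∧
    weightedSobolevNorm σbar M f0 ≤ ENNReal.ofReal C0 ∧
    ∀ ξ : ℂ, ξ.re ≤ 0 → ∀ k : R3,
      IntegrableOn (laplaceIntegrand W f0 ξ k) (Ioi (0 : ℝ)) ∧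
        κ ≤ ‖dispersion W f0 ξ k - 1‖

/-- `W` is the (integrable) fundamental solution of `-Δφ + αφ = ρ`: one has `-ΔW + αW = δ₀` in the
sense of distributions. -/
def IsFundamentalSolution (α : ℝ) (W : R3 → ℝ) : Prop :=
  Integrable W ∧
    ∀ φ : R3 → ℝ, ContDiff ℝ ∞ φ → HasCompactSupport φ →
      ∫ x, W x * (-(Laplacian.laplacian φ x) + α * φ x) = φ 0

/-- `0 ≤ Ŵ(k) ≲ ⟨k⟩^{-2}`; in particular `Ŵ` is real-valued. -/
def NonnegScreened (W : R3 → ℝ) : Prop :=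
  ∃ C : ℝ, ∀ k : R3, (hat W k).im = 0 ∧ 0 ≤ (hat W k).re ∧ (hat W k).re ≤ C * jap k ^ (-2 : ℝ)

/-- `|f(v)| + |∇f(v)| ≲ ⟨v⟩^{-4}` for (almost every) large `|v|`. -/
def DecaysWithGradient (f : R3 → ℝ) : Prop :=
  ∃ C R : ℝ, ∀ᵐ v : R3, R ≤ ‖v‖ →
    DifferentiableAt ℝ f v ∧ |f v| + ‖∇ f v‖ ≤ C * jap v ^ (-4 : ℝ)

end LandauDamping

end

namespace LandauDamping

/-! A radial `f0` with profile `p` has a radial Fourier transform: for `η ≠ 0`, up to a positive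
constant, it is `S(|η|)/|η|`, where `S` is the sine transform of the odd function `u p(u)`
(`hat_radial`). Substituting `r = |k| t` in the dispersion integral absorbs the factor `|k|² t`, so
that for `k ≠ 0` one has `𝓛(ξ,k) = -c Ŵ(k) F(ξ̄/|k|)` with `F(z) = ∫_0^∞ e^{zr} S(r) dr` and `c > 0`
(`dispersion_radial`). All dependence on `k` thus sits in the argument of one function `F` on the
closed left half-plane and in a factor `w = c Ŵ(k)` ranging over a bounded interval `[0, C]`. What
remains is a lower bound for `|1 + w F(z)|`, uniform in `w` and `z`.

Sobolev regularity makes `S` integrable (`integrable_sineTransform`), hence `F` is continuous up to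
the boundary and tends to zero at infinity (`exists_norm_laplace_le`). By compactness it is enough
that `F` misses the open negative real axis (`exists_uniform_gap`). This is Penrose's criterion. For
`Re z < 0`, `F(z) = ∫ u² p(u)/(u² + z²) du`; positivity of `p` makes this nonreal when `Im z ≠ 0`
and nonnegative when `z` is real. On the imaginary axis Fourier inversion gives `Im F(iy) = π y
p(y)`, nonzero for `y ≠ 0`, and `F(0) ≥ 0` is a limit along the negative axis.

The argument uses only that `Ŵ` is real, nonnegative and bounded. For the fundamental solution these
facts follow by computing `Ŵ`, testing the equation against truncated plane waves. -/

/-! ### Fourier integrals of radial functions: reduction to one dimension. -/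

/-- Integrating a function of `√(u² + s²)` against `s ds` amounts to integrating it against `ρ dρ`
over `ρ > |u|`. -/
theorem integral_Ioi_mul_comp_sqrt (u : ℝ) (g : ℝ → ℂ) :
    ∫ s in Ioi (0 : ℝ), (s : ℂ) * g (Real.sqrt (u ^ 2 + s ^ 2)) =
      ∫ ρ in Ioi |u|, (ρ : ℂ) * g ρ := by
  have hpos : ∀ s ∈ Ioi (0 : ℝ), 0 < u ^ 2 + s ^ 2 := fun s hs => by
    have : 0 < s := hs
    positivity
  have himage : (fun s => Real.sqrt (u ^ 2 + s ^ 2)) '' Ioi (0 : ℝ) = Ioi |u| := by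
    ext ρ
    simp only [mem_image, mem_Ioi]
    constructor
    · rintro ⟨s, hs, rfl⟩
      exact Real.lt_sqrt_of_sq_lt (by rw [sq_abs]; nlinarith)
    · intro hρ
      have hlt : u ^ 2 < ρ ^ 2 := by
        rw [← sq_abs u]
        exact pow_lt_pow_left₀ hρ (abs_nonneg u) two_ne_zero
      refine ⟨Real.sqrt (ρ ^ 2 - u ^ 2), Real.sqrt_pos.2 (by linarith), ?_⟩
      rw [Real.sq_sqrt (by linarith), add_sub_cancel, Real.sqrt_sq ((abs_nonneg u).trans hρ.le)]
  have hderiv : ∀ s ∈ Ioi (0 : ℝ), HasDerivWithinAt (fun s => Real.sqrt (u ^ 2 + s ^ 2))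
      (s / Real.sqrt (u ^ 2 + s ^ 2)) (Ioi 0) s := fun s hs => by
    have h := ((((hasDerivAt_id s).pow 2).const_add (u ^ 2)).sqrt (hpos s hs).ne').hasDerivWithinAt
      (s := Ioi (0 : ℝ))
    convert! h using 1
    simp only [id, Pi.pow_apply]
    field_simp
    push_cast
    ring
  have hinj : InjOn (fun s => Real.sqrt (u ^ 2 + s ^ 2)) (Ioi (0 : ℝ)) := by
    intro s hs t ht h
    have h1 := (Real.sqrt_inj (hpos s hs).le (hpos t ht).le).1 h
    have hs' : 0 < s := hs
    have ht' : 0 < t := ht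
    nlinarith
  rw [← himage, integral_image_eq_integral_abs_deriv_smul measurableSet_Ioi hderiv hinj]
  refine setIntegral_congr_fun measurableSet_Ioi fun s hs => ?_
  have hs' : 0 < s := hs
  have hroot := Real.sqrt_pos.2 (hpos s hs)
  rw [abs_of_pos (div_pos hs' hroot), Complex.real_smul, ← mul_assoc, ← Complex.ofReal_mul,
    div_mul_cancel₀ _ hroot.ne']

/-- The Fourier integral of a radial function on `ℝ³`, written with the splitting `ℝ³ = ℝ × ℝ²`. -/
theorem integral_radial_eq_integral_prod (p : ℝ → ℝ) (e : ℝ → ℂ) :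
    ∫ v : R3, e (v 0) * (p ‖v‖ : ℂ) =
      ∫ z : ℝ × EuclideanSpace ℝ (Fin 2), e z.1 * (p (Real.sqrt (z.1 ^ 2 + ‖z.2‖ ^ 2)) : ℂ) ∧
    (Integrable (fun v : R3 => e (v 0) * (p ‖v‖ : ℂ)) → Integrable
      (fun z : ℝ × EuclideanSpace ℝ (Fin 2) =>
        e z.1 * (p (Real.sqrt (z.1 ^ 2 + ‖z.2‖ ^ 2)) : ℂ))) := by
  let T : R3 ≃ᵐ ℝ × EuclideanSpace ℝ (Fin 2) :=
    ((MeasurableEquiv.toLp 2 (Fin 3 → ℝ)).symm.trans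
      (MeasurableEquiv.piFinSuccAbove (fun _ : Fin 3 => ℝ) 0)).trans
      ((MeasurableEquiv.refl ℝ).prodCongr (MeasurableEquiv.toLp 2 (Fin 2 → ℝ)))
  have hT : MeasurePreserving T volume volume := by
    refine MeasurePreserving.trans (MeasurePreserving.trans
      (EuclideanSpace.volume_preserving_symm_measurableEquiv_toLp (Fin 3))
      (volume_preserving_piFinSuccAbove (fun _ : Fin 3 => ℝ) 0)) ?_
    exact (MeasurePreserving.id volume).prod (PiLp.volume_preserving_toLp (Fin 2))
  have hfun : (fun v : R3 => e (v 0) * (p ‖v‖ : ℂ)) =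
      (fun z : ℝ × EuclideanSpace ℝ (Fin 2) =>
        e z.1 * (p (Real.sqrt (z.1 ^ 2 + ‖z.2‖ ^ 2)) : ℂ)) ∘ T := by
    funext v
    have h1 : (T v).1 = v 0 := rfl
    have h2 : ‖(T v).2‖ ^ 2 = v 1 ^ 2 + v 2 ^ 2 := by
      rw [EuclideanSpace.norm_sq_eq, Fin.sum_univ_two, Real.norm_eq_abs, Real.norm_eq_abs, sq_abs,
        sq_abs]
      rfl
    have h3 : ‖v‖ = Real.sqrt (v 0 ^ 2 + (v 1 ^ 2 + v 2 ^ 2)) := by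
      rw [EuclideanSpace.norm_eq, Fin.sum_univ_three]
      simp only [Real.norm_eq_abs, sq_abs, add_assoc]
    simp only [Function.comp_apply, h1, h2, h3]
  constructor
  · rw [hfun]
    exact hT.integral_comp' (fun z : ℝ × EuclideanSpace ℝ (Fin 2) =>
      e z.1 * (p (Real.sqrt (z.1 ^ 2 + ‖z.2‖ ^ 2)) : ℂ))
  · rw [hfun]
    exact (hT.integrable_comp_emb T.measurableEmbedding).1

/-- Radial profiles of integrable functions on `ℝ³` are integrable against `r² dr`. -/
theorem integrableOn_sq_mul_of_integrable_radial {p : ℝ → ℝ}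
    (hp : Integrable fun v : R3 => p ‖v‖) :
    IntegrableOn (fun r => r ^ 2 * p r) (Ioi 0) := by
  simpa using (integrable_fun_norm_addHaar (E := R3) (F := ℝ) volume (f := p)).1 hp

theorem integral_exp_neg_I_mul_Ioo {r ρ : ℝ} (hr : r ≠ 0) (hρ : 0 < ρ) :
    ∫ u in Ioo (-ρ) ρ, Complex.exp (-(Complex.I * ((u * r : ℝ) : ℂ))) =
      ((2 / r * Real.sin (ρ * r) : ℝ) : ℂ) := by
  rw [← integral_Ioc_eq_integral_Ioo, ← intervalIntegral.integral_of_le (by linarith)]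
  have hc : -(Complex.I * (r : ℂ)) ≠ 0 := by simp [hr]
  have := integral_exp_mul_complex (a := -ρ) (b := ρ) hc
  have h2 : ∀ u : ℝ, Complex.exp (-(Complex.I * ((u * r : ℝ) : ℂ))) =
      Complex.exp (-(Complex.I * r) * u) := fun u => by push_cast; ring_nf
  simp_rw [h2]
  rw [this]
  push_cast
  rw [Complex.sin]
  have hr' : (r : ℂ) ≠ 0 := by exact_mod_cast hr
  have e1 : -(Complex.I * (r : ℂ)) * (ρ : ℂ) = -((ρ : ℂ) * r) * Complex.I := by ring
  have e2 : -(Complex.I * (r : ℂ)) * (-(ρ : ℂ)) = ((ρ : ℂ) * r) * Complex.I := by ring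
  rw [e1, e2]
  field_simp
  linear_combination (-Complex.exp (-((ρ : ℂ) * r * Complex.I)) +
    Complex.exp ((ρ : ℂ) * r * Complex.I)) * Complex.I_sq

/-- The area of the unit circle, as it enters the integration in polar coordinates. -/
noncomputable def circleArea : ℝ :=
  2 * volume.real (Metric.ball (0 : EuclideanSpace ℝ (Fin 2)) 1)

theorem circleArea_pos : 0 < circleArea :=
  mul_pos two_pos (ENNReal.toReal_pos (Metric.measure_ball_pos _ _ one_pos).ne'
    measure_ball_lt_top.ne)

/-- The Fourier integral of a radial function on `ℝ³` is a sine transform. -/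
theorem integral_radial_exp {p : ℝ → ℝ} (hc : Continuous p)
    (hp : Integrable fun v : R3 => p ‖v‖) {r : ℝ} (hr : r ≠ 0) :
    ∫ v : R3, Complex.exp (-(Complex.I * ((v 0 * r : ℝ) : ℂ))) * (p ‖v‖ : ℂ) =
      ((circleArea * (2 / r) * ∫ ρ in Ioi (0 : ℝ), ρ * p ρ * Real.sin (ρ * r) : ℝ) : ℂ) := by
  set e : ℝ → ℂ := fun u => Complex.exp (-(Complex.I * ((u * r : ℝ) : ℂ))) with he
  have hecont : Continuous e := by fun_prop
  have henorm : ∀ u, ‖e u‖ = 1 := fun u => by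
    have : -(Complex.I * ((u * r : ℝ) : ℂ)) = ((-(u * r) : ℝ) : ℂ) * Complex.I := by
      push_cast; ring
    rw [he]; simp only [this]
    exact Complex.norm_exp_ofReal_mul_I _
  have hint : Integrable (fun v : R3 => e (v 0) * (p ‖v‖ : ℂ)) := by
    refine hp.ofReal.bdd_mul (c := 1) (by fun_prop) (.of_forall fun v => (henorm _).le)
  have hsplit := integral_radial_eq_integral_prod p e
  have hprod := hsplit.2 hint
  change ∫ v : R3, e (v 0) * (p ‖v‖ : ℂ) = _
  rw [hsplit.1, Measure.volume_eq_prod, integral_prod _ (by rwa [← Measure.volume_eq_prod])]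
  -- Polar coordinates in the plane and `ρ = √(u² + s²)` turn the inner integral into one over `ρ >
  -- |u|`. The indicator keeps this constraint, so that Fubini can integrate over `|u| < ρ` first.
  have hinner : ∀ u : ℝ, ∫ y : EuclideanSpace ℝ (Fin 2),
      e u * (p (Real.sqrt (u ^ 2 + ‖y‖ ^ 2)) : ℂ) =
      circleArea * ∫ ρ in Ioi (0 : ℝ), {z : ℝ × ℝ | |z.1| < z.2}.indicator
        (fun z => e z.1 * ((z.2 * p z.2 : ℝ) : ℂ)) (u, ρ) := by
    intro u
    rw [integral_const_mul, integral_fun_norm_addHaar volume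
      (fun s => (p (Real.sqrt (u ^ 2 + s ^ 2)) : ℂ))]
    have := integral_Ioi_mul_comp_sqrt u (fun ρ => (p ρ : ℂ))
    simp only [finrank_euclideanSpace, Fintype.card_fin, Nat.add_one_sub_one, pow_one,
      Complex.real_smul, nsmul_eq_mul, Nat.cast_ofNat, this]
    have hind : ∀ ρ : ℝ, {z : ℝ × ℝ | |z.1| < z.2}.indicator
        (fun z => e z.1 * ((z.2 * p z.2 : ℝ) : ℂ)) (u, ρ) =
        (Ioi |u|).indicator (fun ρ => e u * ((ρ : ℂ) * (p ρ : ℂ))) ρ := by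
      intro ρ
      by_cases h : |u| < ρ
      · rw [indicator_of_mem (by exact h), indicator_of_mem (by exact h)]
        push_cast; rfl
      · rw [indicator_of_notMem (by exact h), indicator_of_notMem (by exact h)]
    simp_rw [hind]
    rw [integral_indicator measurableSet_Ioi, Measure.restrict_restrict measurableSet_Ioi,
      inter_eq_left.2 (Ioi_subset_Ioi (abs_nonneg u)), integral_const_mul, circleArea]
    push_cast; ring
  simp only [hinner]
  have hS : MeasurableSet {z : ℝ × ℝ | |z.1| < z.2} :=
    (isOpen_lt (by fun_prop) (by fun_prop)).measurableSet
  have hslice : ∀ ρ ∈ Ioi (0 : ℝ), ∀ g : ℝ → ℂ,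
      (fun u => {z : ℝ × ℝ | |z.1| < z.2}.indicator (fun z => g z.1 * ((z.2 * p z.2 : ℝ) : ℂ)) (u, ρ))
        = (Ioo (-ρ) ρ).indicator (fun u => g u * ((ρ * p ρ : ℝ) : ℂ)) := by
    intro ρ _ g
    funext u
    by_cases h : |u| < ρ
    · rw [indicator_of_mem (by exact h), indicator_of_mem (by exact abs_lt.1 h)]
    · rw [indicator_of_notMem (by exact h), indicator_of_notMem (by rw [mem_Ioo, ← abs_lt]; exact h)]
  have hswap : Integrable (Function.uncurry fun u ρ : ℝ => {z : ℝ × ℝ | |z.1| < z.2}.indicator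
      (fun z => e z.1 * ((z.2 * p z.2 : ℝ) : ℂ)) (u, ρ))
      ((volume : Measure ℝ).prod (volume.restrict (Ioi (0 : ℝ)))) := by
    have hmeas : AEStronglyMeasurable (Function.uncurry fun u ρ : ℝ =>
        {z : ℝ × ℝ | |z.1| < z.2}.indicator
        (fun z => e z.1 * ((z.2 * p z.2 : ℝ) : ℂ)) (u, ρ))
        ((volume : Measure ℝ).prod (volume.restrict (Ioi (0 : ℝ)))) := by
      have : Continuous (fun z : ℝ × ℝ => e z.1 * ((z.2 * p z.2 : ℝ) : ℂ)) := by fun_prop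
      exact this.aestronglyMeasurable.indicator hS
    rw [integrable_prod_iff' hmeas]
    constructor
    · filter_upwards [ae_restrict_mem measurableSet_Ioi] with ρ hρ
      simp only [Function.uncurry_apply_pair]
      rw [hslice ρ hρ e, integrable_indicator_iff measurableSet_Ioo]
      exact (Continuous.integrableOn_Icc (by fun_prop)).mono_set Ioo_subset_Icc_self
    -- The slice in `u` has length `2ρ`, so the integrated norm is `2ρ² |p(ρ)|`: exactly the
    -- three-dimensional radial weight.
    · refine ((integrableOn_sq_mul_of_integrable_radial hp).norm.const_mul 2).congr ?_
      filter_upwards [ae_restrict_mem measurableSet_Ioi] with ρ hρ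
      simp only [Function.uncurry_apply_pair]
      have h1 := fun u => congrFun (hslice ρ hρ e) u
      have hρ' : 0 < ρ := hρ
      simp only [h1, norm_indicator_eq_indicator_norm]
      rw [integral_indicator measurableSet_Ioo]
      simp only [norm_mul, henorm, one_mul, setIntegral_const, measureReal_def, Real.volume_Ioo,
        smul_eq_mul, Complex.norm_real, Real.norm_eq_abs, abs_of_pos hρ', abs_pow, sub_neg_eq_add]
      rw [ENNReal.toReal_ofReal (by linarith)]
      ring
  rw [integral_const_mul, integral_integral_swap hswap]
  have hlast : ∫ ρ in Ioi (0 : ℝ), ∫ u : ℝ, {z : ℝ × ℝ | |z.1| < z.2}.indicator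
      (fun z => e z.1 * ((z.2 * p z.2 : ℝ) : ℂ)) (u, ρ) =
      ∫ ρ in Ioi (0 : ℝ), ((2 / r * (ρ * p ρ * Real.sin (ρ * r)) : ℝ) : ℂ) := by
    refine setIntegral_congr_fun measurableSet_Ioi fun ρ hρ => ?_
    rw [hslice ρ hρ e, integral_indicator measurableSet_Ioo, integral_mul_const,
      integral_exp_neg_I_mul_Ioo hr hρ]
    push_cast; ring
  rw [hlast, integral_complex_ofReal, integral_const_mul]
  push_cast; ring

/-- The `L²` Fourier transform of an integrable square integrable function is given by the Fourier
integral. -/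
theorem fourier_toLp_ae_eq {f : R3 → ℂ} (hf : Integrable f) (h2 : MemLp f 2 (volume : Measure R3)) :
    (𝓕 (h2.toLp f : Lp (α := R3) ℂ 2) : Lp (α := R3) ℂ 2) =ᵐ[volume] 𝓕 f := by
  have hcont : Continuous (𝓕 f) :=
    VectorFourier.fourierIntegral_continuous Real.continuous_fourierChar continuous_inner hf
  -- Both sides are compared as distributions: each moves the Fourier transform onto the test
  -- function, the left by the definition on tempered distributions, the right by Fubini.
  refine ae_eq_of_integral_contDiff_smul_eq ((Lp.memLp _).locallyIntegrable one_le_two)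
    hcont.locallyIntegrable fun g hg hgc => ?_
  have hgc' : HasCompactSupport (Complex.ofRealCLM ∘ g) := hgc.comp_left rfl
  have hg' : ContDiff ℝ ∞ (Complex.ofRealCLM ∘ g) := by fun_prop
  set s : SchwartzMap R3 ℂ := hgc'.toSchwartzMap hg' with hs
  have hsg : ∀ x, s x = (g x : ℂ) := fun x => rfl
  have key := DFunLike.congr_fun
    (Lp.fourier_toTemperedDistribution_eq (h2.toLp f : Lp (α := R3) ℂ 2)) s
  rw [TemperedDistribution.fourier_apply, Lp.toTemperedDistribution_apply,
    Lp.toTemperedDistribution_apply] at key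
  have hflip := VectorFourier.integral_fourierIntegral_smul_eq_flip
    (L := innerₗ R3) (μ := (volume : Measure R3)) (ν := (volume : Measure R3))
    Real.continuous_fourierChar continuous_inner s.integrable hf
  rw [flip_innerₗ] at hflip
  generalize (𝓕 (h2.toLp f : Lp (α := R3) ℂ 2) : Lp (α := R3) ℂ 2) = Φ at key ⊢
  have hleft : ∫ x, (𝓕 s) x • (h2.toLp f) x = ∫ x, (𝓕 (s : R3 → ℂ)) x • f x := by
    refine integral_congr_ae ?_
    filter_upwards [h2.coeFn_toLp] with x hx
    rw [hx, SchwartzMap.fourier_coe]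
  have hreal : ∀ Ψ : R3 → ℂ, ∫ x, g x • Ψ x = ∫ x, s x • Ψ x := fun Ψ => by
    simp only [hsg, Complex.real_smul, smul_eq_mul]
  rw [hreal, hreal, ← key, hleft]
  exact hflip

/-! ### The sine transform of the profile and its integrability. -/

/-- The sine transform of the odd function `u ↦ u p(u)`. -/
noncomputable def sineTransform (p : ℝ → ℝ) (r : ℝ) : ℝ :=
  ∫ u, u * p u * Real.sin (u * r)

theorem integral_Ioi_mul_sin {p : ℝ → ℝ} (heven : ∀ r, p (-r) = p r) (r : ℝ) :
    ∫ ρ in Ioi (0 : ℝ), ρ * p ρ * Real.sin (ρ * r) = sineTransform p r / 2 := by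
  have h : ∀ x : ℝ, |x| * p |x| * Real.sin (|x| * r) = x * p x * Real.sin (x * r) := fun x => by
    rcases abs_choice x with hx | hx <;> rw [hx]
    rw [heven, neg_mul x r, Real.sin_neg]; ring
  have := integral_comp_abs (f := fun ρ => ρ * p ρ * Real.sin (ρ * r))
  simp only [h] at this
  rw [sineTransform, this]; ring

/-- An even or odd function that is integrable on the half-line is integrable. -/
theorem integrable_of_integrableOn_Ioi {g : ℝ → ℝ} (hg : IntegrableOn g (Ioi 0))
    (hsymm : ∀ x, |g (-x)| = |g x|) (hmeas : AEStronglyMeasurable g) : Integrable g := by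
  have h1 : IntegrableOn (fun x => g (-x)) (Iio 0) := by
    have := (Measure.measurePreserving_neg (volume : Measure ℝ)).integrableOn_comp_preimage
      (Homeomorph.neg ℝ).measurableEmbedding (f := g) (s := Ioi 0)
    simpa [Function.comp_def] using this.2 hg
  have h2 : IntegrableOn g (Iio 0) :=
    Integrable.mono h1 hmeas.restrict (.of_forall fun x => by
      rw [Real.norm_eq_abs, Real.norm_eq_abs, hsymm])
  have h3 : IntegrableOn g (Iic 0) := (integrableOn_Iic_iff_integrableOn_Iio (by simp)).2 h2
  rw [← integrableOn_univ, ← Iic_union_Ioi (a := (0 : ℝ))]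
  exact h3.union hg

/-- The weight `u²` dominates `u` only beyond `1`; on the bounded remainder continuity of `p`
suffices. -/
theorem integrable_mul_of_integrable_radial {p : ℝ → ℝ} (hc : Continuous p)
    (heven : ∀ r, p (-r) = p r) (hp : Integrable fun v : R3 => p ‖v‖) :
    Integrable fun u => u * p u := by
  refine integrable_of_integrableOn_Ioi ?_ (fun x => by rw [heven]; simp)
    (by fun_prop : Continuous fun u => u * p u).aestronglyMeasurable
  rw [← Ioc_union_Ioi_eq_Ioi (zero_le_one' ℝ)]
  refine ((Continuous.integrableOn_Icc (by fun_prop)).mono_set Ioc_subset_Icc_self).union ?_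
  refine Integrable.mono ((integrableOn_sq_mul_of_integrable_radial hp).mono_set
    (Ioi_subset_Ioi zero_le_one)) (by fun_prop : Continuous fun u => u * p u).aestronglyMeasurable ?_
  filter_upwards [ae_restrict_mem measurableSet_Ioi] with u hu
  have hu' : 1 < u := hu
  rw [norm_mul, norm_mul, Real.norm_of_nonneg (by linarith : 0 ≤ u),
    Real.norm_of_nonneg (by positivity : 0 ≤ u ^ 2)]
  gcongr
  nlinarith

theorem continuous_sineTransform {p : ℝ → ℝ} (hp : Integrable fun u => u * p u) :
    Continuous (sineTransform p) := by
  refine continuous_of_dominated (bound := fun u => ‖u * p u‖) ?_ ?_ hp.norm ?_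
  · exact fun r => hp.aestronglyMeasurable.mul (by fun_prop)
  · refine fun r => .of_forall fun u => ?_
    rw [norm_mul]
    exact mul_le_of_le_one_right (norm_nonneg _) (Real.abs_sin_le_one _)
  · exact .of_forall fun u => by fun_prop

theorem sineTransform_neg (p : ℝ → ℝ) (r : ℝ) : sineTransform p (-r) = -sineTransform p r := by
  simp only [sineTransform, mul_neg, Real.sin_neg, integral_neg]

/-- The Fourier integral of a radial function in terms of the sine transform of its profile. -/
theorem integral_radial_exp_inner {p : ℝ → ℝ} (hc : Continuous p) (heven : ∀ r, p (-r) = p r)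
    (hp : Integrable fun v : R3 => p ‖v‖) {η : R3} (hη : η ≠ 0) :
    ∫ v : R3, Complex.exp (-(Complex.I * ((inner ℝ v η : ℝ) : ℂ))) * (p ‖v‖ : ℂ) =
      ((circleArea / ‖η‖ * sineTransform p ‖η‖ : ℝ) : ℂ) := by
  have hr : ‖η‖ ≠ 0 := norm_ne_zero_iff.2 hη
  set w : R3 := EuclideanSpace.single 0 ‖η‖ with hw
  have hnorm : ‖w‖ = ‖η‖ := by simp [hw]
  -- A reflection taking `|η| e₀` to `η` preserves norm and measure, so the frequency may be assumed
  -- to lie on the first axis.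
  set T := (ℝ ∙ (w - η))ᗮ.reflection with hT
  have hTw : T w = η := Submodule.reflection_sub hnorm
  rw [← (T.measurePreserving).integral_comp T.toHomeomorph.measurableEmbedding]
  have h1 : ∀ v : R3, inner ℝ (T v) η = v 0 * ‖η‖ := fun v => by
    rw [← hTw, T.inner_map_map, hTw, hw, EuclideanSpace.inner_single_right]
    simp [mul_comm]
  simp only [h1, T.norm_map]
  rw [integral_radial_exp hc hp hr, integral_Ioi_mul_sin heven]
  push_cast; ring

theorem hat_radial {f : R3 → ℝ} {p : ℝ → ℝ} (hfp : ∀ v, f v = p ‖v‖) (hc : Continuous p)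
    (heven : ∀ r, p (-r) = p r) (hp : Integrable fun v : R3 => p ‖v‖) {η : R3} (hη : η ≠ 0) :
    hat f η = (((2 * Real.pi) ^ (-(3 / 2) : ℝ) * circleArea / ‖η‖ * sineTransform p ‖η‖ : ℝ) : ℂ) := by
  simp only [hat, hfp]
  rw [integral_radial_exp_inner hc heven hp hη]
  push_cast; ring

theorem fourier_radial {p : ℝ → ℝ} (hc : Continuous p)
    (heven : ∀ r, p (-r) = p r) (hp : Integrable fun v : R3 => p ‖v‖) {ξ : R3} (hξ : ξ ≠ 0) :
    𝓕 (fun v : R3 => (p ‖v‖ : ℂ)) ξ =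
      ((circleArea / (2 * Real.pi * ‖ξ‖) * sineTransform p (2 * Real.pi * ‖ξ‖) : ℝ) : ℂ) := by
  have h2 : (0 : ℝ) < 2 * Real.pi := by positivity
  have h := integral_radial_exp_inner hc heven hp (η := (2 * Real.pi) • ξ)
    (smul_ne_zero h2.ne' hξ)
  rw [norm_smul, Real.norm_eq_abs, abs_of_pos h2] at h
  rw [← h, Real.fourier_eq']
  refine integral_congr_ae (.of_forall fun v => ?_)
  simp only [inner_smul_right, smul_eq_mul]
  congr 2
  push_cast; ring

/-- The sine transform is integrable as soon as the radial function is in `H^σ` with `1 ≤ σ`. -/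
theorem integrable_sineTransform {p : ℝ → ℝ} (hc : Continuous p) (heven : ∀ r, p (-r) = p r)
    (hp : Integrable fun v : R3 => p ‖v‖) {σ : ℝ} (hσ : 1 ≤ σ)
    (hsob : sobolevNorm σ (fun v : R3 => (p ‖v‖ : ℂ)) < ⊤) :
    Integrable (sineTransform p) := by
  have hcont := continuous_sineTransform (integrable_mul_of_integrable_radial hc heven hp)
  have hπ : (0 : ℝ) < 2 * Real.pi := by positivity
  rw [sobolevNorm] at hsob
  split_ifs at hsob with h
  · have hmem : MemLp (fun ξ : R3 => ((jap ((2 * Real.pi) • ξ) ^ σ : ℝ) : ℂ) *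
        (𝓕 (h.toLp _ : Lp (α := R3) ℂ 2) : Lp (α := R3) ℂ 2) ξ) 2 volume := by
      refine ⟨AEStronglyMeasurable.mul ?_ (Lp.aestronglyMeasurable _), hsob⟩
      refine Measurable.aestronglyMeasurable ?_
      unfold jap
      fun_prop
    have hsq := (memLp_two_iff_integrable_sq_norm hmem.1).1 hmem
    have hpc : Integrable (fun v : R3 => (p ‖v‖ : ℂ)) := hp.ofReal
    have hrad : Integrable (fun ξ : R3 => (fun r : ℝ => (Real.sqrt (1 + (2 * Real.pi * r) ^ 2) ^ σ *
        (circleArea / (2 * Real.pi * r) * sineTransform p (2 * Real.pi * r))) ^ 2) ‖ξ‖) := by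
      refine hsq.congr ?_
      filter_upwards [fourier_toLp_ae_eq hpc h, Measure.ae_ne volume (0 : R3)] with ξ hξ hξ0
      rw [hξ, fourier_radial hc heven hp hξ0, ← Complex.ofReal_mul, Complex.norm_real,
        Real.norm_eq_abs, sq_abs, jap, norm_smul, Real.norm_eq_abs, abs_of_pos hπ]
    have hline : IntegrableOn (fun r : ℝ => (2 * Real.pi * r) ^ 2 *
        (Real.sqrt (1 + (2 * Real.pi * r) ^ 2) ^ σ *
        (circleArea / (2 * Real.pi * r) * sineTransform p (2 * Real.pi * r))) ^ 2) (Ioi 0) := by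
      refine ((integrableOn_sq_mul_of_integrable_radial (p := fun r : ℝ =>
        (Real.sqrt (1 + (2 * Real.pi * r) ^ 2) ^ σ * (circleArea / (2 * Real.pi * r) *
        sineTransform p (2 * Real.pi * r))) ^ 2) hrad).const_mul
        ((2 * Real.pi) ^ 2)).congr (.of_forall fun r => ?_)
      ring
    -- Rescaling by `2π` moves from the normalization of `𝓕` to that of `sineTransform`.
    have hline' := (integrableOn_Ioi_comp_mul_left_iff (fun r : ℝ => r ^ 2 *
      (Real.sqrt (1 + r ^ 2) ^ σ * (circleArea / r * sineTransform p r)) ^ 2) 0 hπ).1 hline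
    rw [mul_zero] at hline'
    refine integrable_of_integrableOn_Ioi ?_ (fun x => by rw [sineTransform_neg, abs_neg])
      hcont.aestronglyMeasurable
    refine Integrable.mono' ((hline'.const_mul (circleArea⁻¹ ^ 2)).add
      integrable_inv_one_add_sq.integrableOn) hcont.aestronglyMeasurable ?_
    filter_upwards [ae_restrict_mem measurableSet_Ioi] with r hr
    have hr' : 0 < r := hr
    have hA := circleArea_pos
    simp only [Pi.add_apply]
    have hpos : (0 : ℝ) < 1 + r ^ 2 := by positivity
    have hone : 1 ≤ Real.sqrt (1 + r ^ 2) := Real.one_le_sqrt.2 (by nlinarith)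
    have hge : Real.sqrt (1 + r ^ 2) ≤ Real.sqrt (1 + r ^ 2) ^ σ := by
      simpa using Real.rpow_le_rpow_of_exponent_le hone hσ
    have hsq' : 1 + r ^ 2 ≤ (Real.sqrt (1 + r ^ 2) ^ σ) ^ 2 := by
      calc 1 + r ^ 2 = Real.sqrt (1 + r ^ 2) ^ 2 := (Real.sq_sqrt hpos.le).symm
        _ ≤ _ := by gcongr
    set q := Real.sqrt (1 + r ^ 2) ^ σ
    have heq : circleArea⁻¹ ^ 2 * (r ^ 2 * (q * (circleArea / r * sineTransform p r)) ^ 2) =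
        q ^ 2 * sineTransform p r ^ 2 := by field_simp
    rw [heq, Real.norm_eq_abs]
    have h1 : (1 + r ^ 2) * sineTransform p r ^ 2 ≤ q ^ 2 * sineTransform p r ^ 2 := by gcongr
    -- The pointwise form of Cauchy–Schwarz: `(1 + r²) S²` is integrable by the Sobolev bound with
    -- `σ ≥ 1`, since the factor `1/r²` from the radial transform cancels the Jacobian.
    have h2 : 2 * |sineTransform p r| ≤ (1 + r ^ 2) * sineTransform p r ^ 2 + (1 + r ^ 2)⁻¹ := by
      have h3 : 0 ≤ (1 + r ^ 2)⁻¹ * ((1 + r ^ 2) * |sineTransform p r| - 1) ^ 2 := by positivity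
      have h4 : (1 + r ^ 2)⁻¹ * ((1 + r ^ 2) * |sineTransform p r| - 1) ^ 2 =
          (1 + r ^ 2) * |sineTransform p r| ^ 2 + (1 + r ^ 2)⁻¹ - 2 * |sineTransform p r| := by
        field_simp
        ring
      rw [h4, sq_abs] at h3
      linarith
    linarith [abs_nonneg (sineTransform p r)]
  · exact absurd hsob (lt_irrefl _)

/-! ### Laplace transforms on the closed left half-plane. -/

/-- The transform `z ↦ ∫_0^∞ e^{zr} G(r) dr`. -/
noncomputable def laplace (G : ℝ → ℝ) (z : ℂ) : ℂ :=
  ∫ r in Ioi (0 : ℝ), Complex.exp (z * r) * (G r : ℂ)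

theorem norm_exp_mul_le_one {z : ℂ} (hz : z.re ≤ 0) {r : ℝ} (hr : 0 ≤ r) :
    ‖Complex.exp (z * r)‖ ≤ 1 := by
  rw [Complex.norm_exp, Complex.re_mul_ofReal]
  exact Real.exp_le_one_iff.2 (mul_nonpos_of_nonpos_of_nonneg hz hr)

theorem integrableOn_exp_mul {G : ℝ → ℝ} (hG : Integrable G) {z : ℂ} (hz : z.re ≤ 0) :
    IntegrableOn (fun r : ℝ => Complex.exp (z * r) * (G r : ℂ)) (Ioi 0) := by
  refine Integrable.bdd_mul (c := 1) hG.ofReal.integrableOn (by fun_prop) ?_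
  filter_upwards [ae_restrict_mem measurableSet_Ioi] with r hr
  exact norm_exp_mul_le_one hz (le_of_lt hr)

theorem norm_laplace_le {G : ℝ → ℝ} (hG : Integrable G) {z : ℂ} (hz : z.re ≤ 0) :
    ‖laplace G z‖ ≤ ∫ r, |G r| := by
  calc ‖laplace G z‖ ≤ ∫ r in Ioi (0 : ℝ), |G r| := by
        refine norm_integral_le_of_norm_le hG.abs.integrableOn ?_
        filter_upwards [ae_restrict_mem measurableSet_Ioi] with r hr
        rw [norm_mul, Complex.norm_real, Real.norm_eq_abs]
        exact mul_le_of_le_one_left (abs_nonneg _) (norm_exp_mul_le_one hz (le_of_lt hr))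
    _ ≤ ∫ r, |G r| := setIntegral_le_integral hG.abs (.of_forall fun r => abs_nonneg _)

theorem continuousOn_laplace {G : ℝ → ℝ} (hG : Integrable G) :
    ContinuousOn (laplace G) {z | z.re ≤ 0} := by
  refine continuousOn_of_dominated (bound := fun r => |G r|) ?_ ?_ hG.abs.integrableOn ?_
  · exact fun z hz => (integrableOn_exp_mul hG hz).aestronglyMeasurable
  · intro z hz
    filter_upwards [ae_restrict_mem measurableSet_Ioi] with r hr
    rw [norm_mul, Complex.norm_real, Real.norm_eq_abs]
    exact mul_le_of_le_one_left (abs_nonneg _) (norm_exp_mul_le_one hz (le_of_lt hr))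
  · exact .of_forall fun r => by fun_prop

/-- One integration by parts gains `1/‖z‖`. Since `|e^{zr}| ≤ 1` for `r ≥ 0`, the constant is
uniform up to the imaginary axis. -/
theorem norm_laplace_le_of_contDiff {g : ℝ → ℝ} (hg : ContDiff ℝ ∞ g) (hgc : HasCompactSupport g)
    {z : ℂ} (hz : z.re ≤ 0) (hz0 : z ≠ 0) :
    ‖laplace g z‖ ≤ (|g 0| + ∫ r, |deriv g r|) / ‖z‖ := by
  have hg' : Continuous (deriv g) := hg.continuous_deriv (by simp)
  have hgi : Integrable g := hg.continuous.integrable_of_hasCompactSupport hgc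
  have hgi' : Integrable (deriv g) := hg'.integrable_of_hasCompactSupport hgc.deriv
  have h1 := integrableOn_exp_mul hgi hz
  have h2 := integrableOn_exp_mul hgi' hz
  have hd : ∀ r : ℝ, HasDerivAt (fun r : ℝ => Complex.exp (z * r) * (g r : ℂ))
      (z * (Complex.exp (z * r) * (g r : ℂ)) + Complex.exp (z * r) * ((deriv g r : ℝ) : ℂ)) r := by
    intro r
    have he : HasDerivAt (fun r : ℝ => Complex.exp (z * r)) (Complex.exp (z * r) * z) r := by
      have := ((hasDerivAt_id r).ofReal_comp.const_mul z).cexp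
      simpa using this
    have hgd := ((hg.differentiable (by simp) r).hasDerivAt).ofReal_comp
    convert! he.mul hgd using 1
    ring
  have hlim : Filter.Tendsto (fun r : ℝ => Complex.exp (z * r) * (g r : ℂ)) Filter.atTop
      (nhds 0) := by
    obtain ⟨R, hR⟩ := hgc.isCompact.isBounded.subset_closedBall 0
    refine tendsto_const_nhds.congr' ?_
    filter_upwards [Filter.eventually_gt_atTop R, Filter.eventually_ge_atTop 0] with r hr hr0
    have : g r = 0 := by
      by_contra h
      have := hR (subset_tsupport g h)
      rw [mem_closedBall_zero_iff, Real.norm_of_nonneg hr0] at this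
      linarith
    simp [this]
  have key := integral_Ioi_of_hasDerivAt_of_tendsto
    (hd 0).continuousAt.continuousWithinAt (fun r _ => hd r)
    ((h1.const_mul z).add h2) hlim
  rw [integral_add (h1.const_mul z) h2, integral_const_mul] at key
  change z * laplace g z + laplace (deriv g) z = _ at key
  rw [le_div_iff₀ (norm_pos_iff.2 hz0), mul_comm, ← norm_mul]
  have hsolve : z * laplace g z = -(g 0 : ℂ) - laplace (deriv g) z := by
    rw [eq_sub_iff_add_eq, key]; simp
  rw [hsolve]
  calc ‖-(g 0 : ℂ) - laplace (deriv g) z‖ ≤ ‖-(g 0 : ℂ)‖ + ‖laplace (deriv g) z‖ := norm_sub_le _ _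
    _ ≤ _ := by
      rw [norm_neg, Complex.norm_real, Real.norm_eq_abs]
      gcongr
      exact norm_laplace_le hgi' hz

/-- A Riemann–Lebesgue lemma for the closed half-plane. -/
theorem exists_norm_laplace_le {G : ℝ → ℝ} (hG : Integrable G) {ε : ℝ} (hε : 0 < ε) :
    ∃ R : ℝ, ∀ z : ℂ, z.re ≤ 0 → R ≤ ‖z‖ → ‖laplace G z‖ ≤ ε := by
  obtain ⟨g, hgc, hg, hGg⟩ := MemLp.exist_eLpNorm_sub_le ENNReal.one_ne_top le_rfl
    (memLp_one_iff_integrable.2 hG) (half_pos hε)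
  have hgi : Integrable g := hg.continuous.integrable_of_hasCompactSupport hgc
  set D := |g 0| + ∫ r, |deriv g r| with hD
  have hD0 : 0 ≤ D := by positivity
  -- The threshold makes `D / ‖z‖ ≤ ε / 2`; the added `1` keeps `z` away from `0`, even when `D =
  -- 0`.
  refine ⟨2 * D / ε + 1, fun z hz hR => ?_⟩
  have hzpos : 0 < ‖z‖ := lt_of_lt_of_le (by positivity) hR
  have hdist : ∫ r, |(G - g) r| ≤ ε / 2 := by
    have := integral_norm_eq_lintegral_enorm (hG.sub hgi).aestronglyMeasurable
    rw [← eLpNorm_one_eq_lintegral_enorm] at this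
    calc ∫ r, |(G - g) r| = (eLpNorm (G - g) 1 volume).toReal := this
      _ ≤ (ENNReal.ofReal (ε / 2)).toReal := ENNReal.toReal_mono ENNReal.ofReal_ne_top hGg
      _ = ε / 2 := ENNReal.toReal_ofReal (by positivity)
  have hsplit : laplace G z = laplace (G - g) z + laplace g z := by
    rw [laplace, laplace, laplace, ← integral_add (integrableOn_exp_mul (hG.sub hgi) hz)
      (integrableOn_exp_mul hgi hz)]
    refine integral_congr_ae (.of_forall fun r => ?_)
    simp only [Pi.sub_apply]
    push_cast; ring
  calc ‖laplace G z‖ ≤ ‖laplace (G - g) z‖ + ‖laplace g z‖ := hsplit ▸ norm_add_le _ _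
    _ ≤ ε / 2 + D / ‖z‖ := by
      gcongr
      · exact (norm_laplace_le (hG.sub hgi) hz).trans hdist
      · exact norm_laplace_le_of_contDiff hg hgc hz (norm_pos_iff.1 hzpos)
    _ ≤ ε / 2 + ε / 2 := by
      have h : 2 * D / ε ≤ ‖z‖ := by linarith
      rw [div_le_iff₀ hε] at h
      have : D / ‖z‖ ≤ ε / 2 := by
        rw [div_le_iff₀ hzpos]
        linarith
      linarith
    _ = ε := add_halves ε

/-! ### The Penrose criterion. -/

theorem sq_add_sq_ne_zero {z : ℂ} (hz : z.re < 0) (u : ℝ) : (u : ℂ) ^ 2 + z ^ 2 ≠ 0 := by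
  have h1 : z + Complex.I * u ≠ 0 := fun h => by
    have := congrArg Complex.re h
    simp at this
    linarith
  have h2 : z - Complex.I * u ≠ 0 := fun h => by
    have := congrArg Complex.re h
    simp at this
    linarith
  have : (u : ℂ) ^ 2 + z ^ 2 = (z + Complex.I * u) * (z - Complex.I * u) := by
    linear_combination (u : ℂ) ^ 2 * Complex.I_sq
  rw [this]
  exact mul_ne_zero h1 h2

theorem integral_exp_mul_sin {z : ℂ} (hz : z.re < 0) (u : ℝ) :
    ∫ r in Ioi (0 : ℝ), Complex.exp (z * r) * (Real.sin (u * r) : ℂ) =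
      (u : ℂ) / ((u : ℂ) ^ 2 + z ^ 2) := by
  have hp : (z + Complex.I * u).re < 0 := by simpa using hz
  have hm : (z - Complex.I * u).re < 0 := by simpa using hz
  have hp0 : z + Complex.I * u ≠ 0 := fun h => by rw [h] at hp; simp at hp
  have hm0 : z - Complex.I * u ≠ 0 := fun h => by rw [h] at hm; simp at hm
  have hsin : ∀ r : ℝ, Complex.exp (z * r) * (Real.sin (u * r) : ℂ) =
      (Complex.I / 2) * (Complex.exp ((z - Complex.I * u) * r) -
        Complex.exp ((z + Complex.I * u) * r)) := fun r => by
    have e1 : (z - Complex.I * u) * r = z * r + -((u : ℂ) * r) * Complex.I := by ring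
    have e2 : (z + Complex.I * u) * r = z * r + ((u : ℂ) * r) * Complex.I := by ring
    rw [e1, e2, Complex.exp_add, Complex.exp_add, Complex.ofReal_sin, Complex.sin]
    push_cast; ring
  simp_rw [hsin]
  rw [integral_const_mul, integral_sub (integrableOn_exp_mul_complex_Ioi hm 0)
    (integrableOn_exp_mul_complex_Ioi hp 0), integral_exp_mul_complex_Ioi hm,
    integral_exp_mul_complex_Ioi hp]
  have h3 := sq_add_sq_ne_zero hz u
  simp only [Complex.ofReal_zero, mul_zero, Complex.exp_zero]
  field_simp
  ring_nf
  linear_combination (-2 * u * z ^ 2) * Complex.I_sq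

/-- In the open half-plane the transform of `sineTransform p` is the Penrose integral. -/
theorem laplace_sineTransform {p : ℝ → ℝ} (hp : Integrable fun u => u * p u) {z : ℂ}
    (hz : z.re < 0) :
    Integrable (fun u : ℝ => ((u * p u : ℝ) : ℂ) * ((u : ℂ) / ((u : ℂ) ^ 2 + z ^ 2))) ∧
    laplace (sineTransform p) z =
      ∫ u : ℝ, ((u * p u : ℝ) : ℂ) * ((u : ℂ) / ((u : ℂ) ^ 2 + z ^ 2)) := by
  have hexp : IntegrableOn (fun r : ℝ => Complex.exp (z * r)) (Ioi 0) :=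
    integrableOn_exp_mul_complex_Ioi hz 0
  have hpc : Integrable (fun u : ℝ => ((u * p u : ℝ) : ℂ)) := hp.ofReal
  have hprod : Integrable (Function.uncurry fun r u : ℝ =>
      Complex.exp (z * r) * ((u * p u : ℝ) : ℂ) * (Real.sin (u * r) : ℂ))
      ((volume.restrict (Ioi (0 : ℝ))).prod volume) := by
    refine Integrable.mul_bdd (c := 1) (hexp.mul_prod hpc) ?_ (.of_forall fun q => ?_)
    · have : Continuous fun q : ℝ × ℝ => (Real.sin (q.2 * q.1) : ℂ) := by fun_prop
      exact this.aestronglyMeasurable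
    · rw [Complex.norm_real]
      exact Real.abs_sin_le_one _
  have hinner : ∀ u : ℝ, ∫ r in Ioi (0 : ℝ),
      Complex.exp (z * r) * ((u * p u : ℝ) : ℂ) * (Real.sin (u * r) : ℂ) =
      ((u * p u : ℝ) : ℂ) * ((u : ℂ) / ((u : ℂ) ^ 2 + z ^ 2)) := fun u => by
    rw [← integral_exp_mul_sin hz u, ← integral_const_mul]
    refine integral_congr_ae (.of_forall fun r => ?_)
    ring
  constructor
  · refine hprod.integral_prod_right.congr (.of_forall fun u => ?_)
    exact hinner u
  · simp_rw [← hinner]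
    rw [← integral_integral_swap hprod, laplace]
    refine integral_congr_ae (.of_forall fun r => ?_)
    simp only [sineTransform]
    rw [← integral_complex_ofReal, ← integral_const_mul]
    refine integral_congr_ae (.of_forall fun u => ?_)
    simp only
    push_cast; ring

/-- The imaginary part of `1/(u² + z²)` is `-2 Re z Im z / |u² + z²|²`, of one sign for all `u`, so
positivity of `p` excludes cancellation. -/
theorem im_laplace_sineTransform_ne_zero {p : ℝ → ℝ} (hpos : ∀ u, 0 < p u)
    (hp : Integrable fun u => u * p u) {z : ℂ} (hz : z.re < 0) (hz' : z.im ≠ 0) :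
    (laplace (sineTransform p) z).im ≠ 0 := by
  obtain ⟨hint, heq⟩ := laplace_sineTransform hp hz
  have him : ∀ u : ℝ, (((u * p u : ℝ) : ℂ) * ((u : ℂ) / ((u : ℂ) ^ 2 + z ^ 2))).im =
      (-2 * z.re * z.im) * (u ^ 2 * p u / Complex.normSq ((u : ℂ) ^ 2 + z ^ 2)) := fun u => by
    rw [mul_div_assoc', ← Complex.ofReal_mul, Complex.div_im, Complex.ofReal_im, Complex.ofReal_re]
    have : ((u : ℂ) ^ 2 + z ^ 2).im = 2 * z.re * z.im := by
      simp [pow_two]; ring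
    rw [this]; ring
  have hc : -2 * z.re * z.im ≠ 0 := by simp [hz.ne, hz']
  have hq : Integrable fun u : ℝ => u ^ 2 * p u / Complex.normSq ((u : ℂ) ^ 2 + z ^ 2) := by
    have := hint.im
    simp only [RCLike.im_to_complex, him] at this
    exact (integrable_const_mul_iff (isUnit_iff_ne_zero.2 hc) _).1 this
  have hnn : 0 ≤ fun u : ℝ => u ^ 2 * p u / Complex.normSq ((u : ℂ) ^ 2 + z ^ 2) := fun u =>
    div_nonneg (mul_nonneg (sq_nonneg u) (hpos u).le) (Complex.normSq_nonneg _)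
  have hposint := (integral_pos_iff_support_of_nonneg hnn hq).2 <| by
    refine lt_of_lt_of_le (b := volume (Ioi (0 : ℝ))) (by simp) (measure_mono fun u hu => ?_)
    have hu' : 0 < u := hu
    exact (div_pos (mul_pos (by positivity) (hpos u))
      (Complex.normSq_pos.2 (sq_add_sq_ne_zero hz u))).ne'
  have h : (laplace (sineTransform p) z).im = (-2 * z.re * z.im) *
      ∫ u : ℝ, u ^ 2 * p u / Complex.normSq ((u : ℂ) ^ 2 + z ^ 2) := by
    rw [heq, ← integral_const_mul]
    simp_rw [← him]
    exact (integral_im hint).symm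
  rw [h]
  exact mul_ne_zero hc hposint.ne'

theorem re_laplace_sineTransform_nonneg {p : ℝ → ℝ} (hpos : ∀ u, 0 < p u)
    (hp : Integrable fun u => u * p u) {x : ℝ} (hx : x < 0) :
    0 ≤ (laplace (sineTransform p) x).re := by
  rw [(laplace_sineTransform hp (z := x) (by simpa using hx)).2]
  have : ∀ u : ℝ, ((u * p u : ℝ) : ℂ) * ((u : ℂ) / ((u : ℂ) ^ 2 + (x : ℂ) ^ 2)) =
      ((u ^ 2 * p u / (u ^ 2 + x ^ 2) : ℝ) : ℂ) := fun u => by push_cast; ring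
  simp_rw [this]
  rw [integral_complex_ofReal, Complex.ofReal_re]
  exact integral_nonneg fun u => div_nonneg (mul_nonneg (sq_nonneg u) (hpos u).le) (by positivity)

/-- Puts the sine transform in the form to which Fourier inversion applies. Averaging over `u` and
`-u` leaves only the sine part of the exponential. -/
theorem fourier_odd_eq_sineTransform {p : ℝ → ℝ} (heven : ∀ r, p (-r) = p r)
    (hp : Integrable fun u => u * p u) (ξ : ℝ) :
    𝓕 (fun u : ℝ => ((u * p u : ℝ) : ℂ)) ξ =
      -(Complex.I * (sineTransform p (2 * Real.pi * ξ) : ℂ)) := by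
  set e : ℝ → ℂ := fun u => Complex.exp (((-2 * Real.pi * u * ξ : ℝ) : ℂ) * Complex.I) with he
  have hpc : Integrable (fun u : ℝ => ((u * p u : ℝ) : ℂ)) := hp.ofReal
  have hei : Integrable fun u : ℝ => e u * ((u * p u : ℝ) : ℂ) :=
    hpc.bdd_mul (c := 1) (by fun_prop) (.of_forall fun u =>
      (Complex.norm_exp_ofReal_mul_I _).le)
  have h1 : 𝓕 (fun u : ℝ => ((u * p u : ℝ) : ℂ)) ξ = ∫ u : ℝ, e u * ((u * p u : ℝ) : ℂ) := by
    rw [Real.fourier_real_eq_integral_exp_smul]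
    rfl
  have h2 := integral_neg_eq_self (fun u : ℝ => e u * ((u * p u : ℝ) : ℂ)) volume
  have h3 : ∫ u : ℝ, (e u * ((u * p u : ℝ) : ℂ) + e (-u) * ((-u * p (-u) : ℝ) : ℂ)) =
      -(2 * Complex.I) * (sineTransform p (2 * Real.pi * ξ) : ℂ) := by
    rw [sineTransform, ← integral_complex_ofReal, ← integral_const_mul]
    refine integral_congr_ae (.of_forall fun u => ?_)
    have e1 : (((-2 * Real.pi * u * ξ : ℝ) : ℂ) * Complex.I) =
      -((u : ℂ) * (2 * Real.pi * ξ)) * Complex.I := by push_cast; ring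
    have e2 : (((-2 * Real.pi * -u * ξ : ℝ) : ℂ) * Complex.I) =
      ((u : ℂ) * (2 * Real.pi * ξ)) * Complex.I := by push_cast; ring
    simp only [he, heven, e1, e2]
    push_cast
    rw [Complex.sin]
    linear_combination (u : ℂ) * p u * (Complex.exp (-((u : ℂ) * (2 * Real.pi * ξ)) * Complex.I) -
      Complex.exp ((u : ℂ) * (2 * Real.pi * ξ) * Complex.I)) * Complex.I_sq
  rw [integral_add hei hei.comp_neg, h2] at h3
  rw [h1]
  linear_combination h3 / 2

/-- On the imaginary axis the imaginary part of the transform is the Penrose derivative term. -/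
theorem im_laplace_sineTransform_I_mul {p : ℝ → ℝ} (hc : Continuous p)
    (heven : ∀ r, p (-r) = p r) (hp : Integrable fun u => u * p u)
    (hS : Integrable (sineTransform p)) (y : ℝ) :
    (laplace (sineTransform p) (Complex.I * y)).im = Real.pi * (y * p y) := by
  have hπ : (0 : ℝ) < 2 * Real.pi := by positivity
  have hcont : Continuous fun u : ℝ => ((u * p u : ℝ) : ℂ) := by fun_prop
  have hpc : Integrable (fun u : ℝ => ((u * p u : ℝ) : ℂ)) := hp.ofReal
  have hSc : Integrable (fun r : ℝ => (sineTransform p r : ℂ)) := hS.ofReal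
  have hF : 𝓕 (fun u : ℝ => ((u * p u : ℝ) : ℂ)) =
      fun ξ => -(Complex.I * (sineTransform p (2 * Real.pi * ξ) : ℂ)) :=
    funext fun ξ => fourier_odd_eq_sineTransform heven hp ξ
  have hFi : Integrable (𝓕 (fun u : ℝ => ((u * p u : ℝ) : ℂ))) := by
    rw [hF]
    exact ((hSc.comp_mul_left' hπ.ne').const_mul Complex.I).neg
  have hinv := congrFun (hcont.fourierInv_fourier_eq hpc hFi) y
  rw [hF, Real.fourierInv_eq'] at hinv
  set E : ℝ → ℂ := fun r => Complex.exp (Complex.I * y * r) * (sineTransform p r : ℂ) with hE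
  have hEi : Integrable E := by
    refine hSc.bdd_mul (c := 1) (by fun_prop) (.of_forall fun r => ?_)
    have : Complex.I * y * r = ((y * r : ℝ) : ℂ) * Complex.I := by push_cast; ring
    rw [this]
    exact (Complex.norm_exp_ofReal_mul_I _).le
  have hscale : ∫ v : ℝ, Complex.exp (((2 * Real.pi * inner ℝ v y : ℝ) : ℂ) * Complex.I) •
      -(Complex.I * (sineTransform p (2 * Real.pi * v) : ℂ)) =
      -Complex.I * ((((2 * Real.pi)⁻¹ : ℝ) : ℂ) * ∫ r, E r) := by
    have := Measure.integral_comp_mul_left E (2 * Real.pi)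
    rw [abs_of_pos (inv_pos.2 hπ), Complex.real_smul] at this
    rw [← this, ← integral_const_mul]
    refine integral_congr_ae (.of_forall fun v => ?_)
    have e1 : ((2 * Real.pi * inner ℝ v y : ℝ) : ℂ) * Complex.I =
        Complex.I * y * ((2 * Real.pi * v : ℝ) : ℂ) := by
      simp only [RCLike.inner_apply, conj_trivial]
      push_cast; ring
    simp only [hE, e1, smul_eq_mul]
    ring
  rw [hscale] at hinv
  -- Since `S` is real and odd, `E(-r) = -conj (E r)`. The integral over the line is therefore `L -
  -- conj L = 2i Im L`, which inversion evaluates.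
  have hneg : ∫ r in Iic (0 : ℝ), E r = -conj (laplace (sineTransform p) (Complex.I * y)) := by
    rw [← neg_zero, ← integral_comp_neg_Ioi, laplace, ← integral_conj, ← integral_neg]
    refine integral_congr_ae (.of_forall fun r => ?_)
    simp only [hE, sineTransform_neg, map_mul, Complex.conj_ofReal, ← Complex.exp_conj,
      Complex.conj_I]
    push_cast
    ring_nf
  have hsum := intervalIntegral.integral_Iic_add_Ioi (b := (0 : ℝ)) hEi.integrableOn hEi.integrableOn
  have hposE : ∫ r in Ioi (0 : ℝ), E r = laplace (sineTransform p) (Complex.I * y) := rfl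
  rw [hneg, hposE] at hsum
  set L := laplace (sineTransform p) (Complex.I * y)
  have hsub : -conj L + L = ((2 * L.im : ℝ) : ℂ) * Complex.I := by
    rw [neg_add_eq_sub, Complex.sub_conj]
  rw [← hsum, hsub] at hinv
  have hπc : (Real.pi : ℂ) ≠ 0 := by exact_mod_cast Real.pi_pos.ne'
  have hfin : ((L.im : ℝ) : ℂ) = ((Real.pi * (y * p y) : ℝ) : ℂ) := by
    push_cast at hinv ⊢
    rw [← hinv]
    field_simp
    linear_combination (L.im : ℂ) * Complex.I_sq
  exact_mod_cast hfin

/-- The Penrose condition: the transform avoids the negative real axis. -/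
theorem laplace_sineTransform_avoids_neg {p : ℝ → ℝ} (hc : Continuous p) (hpos : ∀ u, 0 < p u)
    (heven : ∀ r, p (-r) = p r) (hp : Integrable fun u => u * p u)
    (hS : Integrable (sineTransform p)) {z : ℂ} (hz : z.re ≤ 0) :
    (laplace (sineTransform p) z).im ≠ 0 ∨ 0 ≤ (laplace (sineTransform p) z).re := by
  rcases hz.lt_or_eq with hlt | heq
  · by_cases him : z.im = 0
    · right
      have : z = (z.re : ℂ) := Complex.ext rfl (by simpa using him)
      rw [this]
      exact re_laplace_sineTransform_nonneg hpos hp hlt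
    · exact Or.inl (im_laplace_sineTransform_ne_zero hpos hp hlt him)
  · by_cases him : z.im = 0
    · right
      have hz0 : z = 0 := Complex.ext heq him
      rw [hz0]
      -- At `z = 0` the inversion formula gives imaginary part zero and decides nothing, so the sign
      -- of the real part is obtained from the left by continuity.
      have hcw := (continuousOn_laplace hS) 0 (by simp)
      have htend : Filter.Tendsto (fun x : ℝ => (laplace (sineTransform p) x).re)
          (nhdsWithin 0 (Iio 0)) (nhds (laplace (sineTransform p) 0).re) := by
        refine (Complex.continuous_re.tendsto _).comp (hcw.tendsto.comp ?_)
        refine tendsto_nhdsWithin_iff.2 ⟨?_, ?_⟩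
        · have := (Complex.continuous_ofReal.tendsto (0 : ℝ)).mono_left
            (nhdsWithin_le_nhds (s := Iio (0 : ℝ)))
          simpa using this
        · filter_upwards [self_mem_nhdsWithin] with x hx
          simpa using le_of_lt hx
      refine ge_of_tendsto htend ?_
      filter_upwards [self_mem_nhdsWithin] with x hx
      exact re_laplace_sineTransform_nonneg hpos hp hx
    · left
      have hzI : z = Complex.I * z.im := by
        apply Complex.ext <;> simp [heq]
      rw [hzI, im_laplace_sineTransform_I_mul hc heven hp hS]
      exact mul_ne_zero Real.pi_pos.ne' (mul_ne_zero him (hpos _).ne')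

/-! ### The uniform gap. -/

/-- A function on the closed half-plane that is continuous, vanishes at infinity and avoids the
negative real axis stays uniformly away from `-1` after scaling by bounded nonnegative factors. -/
theorem exists_uniform_gap {F : ℂ → ℂ} (hF : ContinuousOn F {z | z.re ≤ 0})
    (hinf : ∀ ε : ℝ, 0 < ε → ∃ R : ℝ, ∀ z : ℂ, z.re ≤ 0 → R ≤ ‖z‖ → ‖F z‖ ≤ ε)
    (hneg : ∀ z : ℂ, z.re ≤ 0 → (F z).im ≠ 0 ∨ 0 ≤ (F z).re) (C : ℝ) :
    ∃ κ : ℝ, 0 < κ ∧ ∀ z : ℂ, z.re ≤ 0 → ∀ w ∈ Icc 0 C, κ ≤ ‖1 + (w : ℂ) * F z‖ := by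
  have hCpos : 0 < |C| + 1 := by positivity
  -- This tolerance forces `|w F(z)| ≤ 1/2` for every `w ∈ [0, C]` once `‖z‖ ≥ R`.
  obtain ⟨R, hR⟩ := hinf (1 / (2 * (|C| + 1))) (by positivity)
  have hfar : ∀ z : ℂ, z.re ≤ 0 → R ≤ ‖z‖ → ∀ w ∈ Icc 0 C, 1 / 2 ≤ ‖1 + (w : ℂ) * F z‖ := by
    intro z hz hzR w hw
    have h1 : ‖(w : ℂ) * F z‖ ≤ 1 / 2 := by
      rw [norm_mul, Complex.norm_real, Real.norm_of_nonneg hw.1]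
      calc w * ‖F z‖ ≤ (|C| + 1) * (1 / (2 * (|C| + 1))) := by
            gcongr
            · linarith [hw.2, le_abs_self C]
            · exact hR z hz hzR
        _ = 1 / 2 := by field_simp
    have h2 := norm_sub_norm_le (1 : ℂ) (-((w : ℂ) * F z))
    rw [norm_neg, norm_one, sub_neg_eq_add] at h2
    linarith
  set K : Set (ℝ × ℂ) := Icc 0 C ×ˢ (Metric.closedBall 0 R ∩ {z | z.re ≤ 0}) with hK
  have hKc : IsCompact K := isCompact_Icc.prod
    ((isCompact_closedBall 0 R).inter_right (isClosed_le Complex.continuous_re continuous_const))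
  have hcont : ContinuousOn (fun q : ℝ × ℂ => ‖1 + (q.1 : ℂ) * F q.2‖) K := by
    refine (continuousOn_const.add (ContinuousOn.mul (by fun_prop) ?_)).norm
    exact hF.comp continuousOn_snd fun q hq => hq.2.2
  have hne : ∀ z : ℂ, z.re ≤ 0 → ∀ w ∈ Icc 0 C, 1 + (w : ℂ) * F z ≠ 0 := by
    intro z hz w hw h
    have hre := congrArg Complex.re h
    have him := congrArg Complex.im h
    simp at hre him
    rcases hneg z hz with h1 | h1
    · rcases him with h2 | h2
      · rw [h2] at hre; simp at hre
      · exact h1 h2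
    · nlinarith [mul_nonneg hw.1 h1]
  obtain ⟨κ, hκ, hκK⟩ : ∃ κ : ℝ, 0 < κ ∧ ∀ q ∈ K, κ ≤ ‖1 + (q.1 : ℂ) * F q.2‖ := by
    rcases K.eq_empty_or_nonempty with hemp | hnon
    -- `K` can be empty, as neither `C` nor `R` is known to be nonnegative; any positive constant
    -- then serves.
    · exact ⟨1, one_pos, fun q hq => by simp [hemp] at hq⟩
    · obtain ⟨q, hq, hmin⟩ := hKc.exists_isMinOn hnon hcont
      exact ⟨_, norm_pos_iff.2 (hne q.2 hq.2.2 q.1 hq.1), fun q' hq' => hmin hq'⟩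
  refine ⟨min κ (1 / 2), by positivity, fun z hz w hw => ?_⟩
  by_cases hzR : R ≤ ‖z‖
  · exact (min_le_right _ _).trans (hfar z hz hzR w hw)
  · refine (min_le_left _ _).trans (hκK (w, z) ⟨hw, ?_, hz⟩)
    rw [mem_closedBall_zero_iff]
    exact (not_le.1 hzR).le

/-! ### The dispersion function and condition (L). -/

theorem hat_eq_ofReal_re {W : R3 → ℝ} {k : R3} (h : (hat W k).im = 0) :
    hat W k = ((hat W k).re : ℂ) :=
  Complex.ext rfl (by simpa using h)

theorem laplaceIntegrand_zero_right (W f0 : R3 → ℝ) (ξ : ℂ) :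
    laplaceIntegrand W f0 ξ 0 = fun _ => 0 := by
  funext t
  simp [laplaceIntegrand]

theorem laplaceIntegrand_radial {W f : R3 → ℝ} {p : ℝ → ℝ} (hfp : ∀ v, f v = p ‖v‖)
    (hc : Continuous p) (heven : ∀ r, p (-r) = p r) (hp : Integrable fun v : R3 => p ‖v‖)
    (ξ : ℂ) {k : R3} (hk : k ≠ 0) {t : ℝ} (ht : 0 < t) :
    laplaceIntegrand W f ξ k t =
      ((((2 * Real.pi) ^ (-(3 / 2) : ℝ) * circleArea * ‖k‖ : ℝ) : ℂ) * hat W k) *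
        (Complex.exp (conj ξ / (‖k‖ : ℂ) * ((‖k‖ * t : ℝ) : ℂ)) *
          (sineTransform p (‖k‖ * t) : ℂ)) := by
  have hk' : (‖k‖ : ℂ) ≠ 0 := by exact_mod_cast norm_ne_zero_iff.2 hk
  have ht' : (t : ℂ) ≠ 0 := by exact_mod_cast ht.ne'
  have hexp : conj ξ / (‖k‖ : ℂ) * ((‖k‖ * t : ℝ) : ℂ) = conj ξ * t := by
    push_cast; field_simp
  rw [laplaceIntegrand, hat_radial hfp hc heven hp (smul_ne_zero ht.ne' hk), norm_smul,
    Real.norm_of_nonneg ht.le, hexp, mul_comm t ‖k‖]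
  push_cast
  field_simp

/-- The substitution `r = |k| t` contributes `1/|k|`, which cancels the single power of `|k|` left
in the integrand. Hence no singularity at `k = 0` and no growth in `k` beyond `Ŵ` survive. -/
theorem dispersion_radial {W f : R3 → ℝ} {p : ℝ → ℝ} (hfp : ∀ v, f v = p ‖v‖)
    (hc : Continuous p) (heven : ∀ r, p (-r) = p r) (hp : Integrable fun v : R3 => p ‖v‖)
    (hS : Integrable (sineTransform p)) {ξ : ℂ} (hξ : ξ.re ≤ 0) {k : R3} (hk : k ≠ 0) :
    IntegrableOn (laplaceIntegrand W f ξ k) (Ioi 0) ∧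
      dispersion W f ξ k =
        -(hat W k * ((((2 * Real.pi) ^ (-(3 / 2) : ℝ) * circleArea : ℝ) : ℂ) *
          laplace (sineTransform p) (conj ξ / (‖k‖ : ℂ)))) := by
  have hkpos : 0 < ‖k‖ := norm_pos_iff.2 hk
  have hre : (conj ξ / (‖k‖ : ℂ)).re ≤ 0 := by
    rw [Complex.div_ofReal_re, Complex.conj_re]
    exact div_nonpos_of_nonpos_of_nonneg hξ hkpos.le
  set g : ℝ → ℂ := fun r => Complex.exp (conj ξ / (‖k‖ : ℂ) * (r : ℂ)) * (sineTransform p r : ℂ)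
    with hg
  have hgi : IntegrableOn g (Ioi 0) := integrableOn_exp_mul hS hre
  have heq : EqOn (laplaceIntegrand W f ξ k)
      (fun t => ((((2 * Real.pi) ^ (-(3 / 2) : ℝ) * circleArea * ‖k‖ : ℝ) : ℂ) * hat W k) *
        g (‖k‖ * t)) (Ioi 0) :=
    fun t ht => laplaceIntegrand_radial hfp hc heven hp ξ hk ht
  constructor
  · rw [integrableOn_congr_fun heq measurableSet_Ioi]
    refine Integrable.const_mul ?_ _
    exact (integrableOn_Ioi_comp_mul_left_iff g 0 hkpos).2 (by simpa using hgi)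
  · have hl : laplace (sineTransform p) (conj ξ / (‖k‖ : ℂ)) = ∫ r in Ioi (0 : ℝ), g r := rfl
    rw [dispersion, setIntegral_congr_fun measurableSet_Ioi heq, integral_const_mul,
      integral_comp_mul_left_Ioi g 0 hkpos, mul_zero, hl, Complex.real_smul]
    have hk' : (‖k‖ : ℂ) ≠ 0 := by exact_mod_cast hkpos.ne'
    push_cast
    field_simp

theorem integrable_of_decaysWithGradient {f : R3 → ℝ} (hc : Continuous f)
    (hd : DecaysWithGradient f) : Integrable f := by
  obtain ⟨C, R, h⟩ := hd
  have hj : Integrable fun v : R3 => jap v ^ (-4 : ℝ) := by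
    refine (integrable_rpow_neg_one_add_norm_sq (E := R3) (μ := volume) (r := 4)
      (by simp; norm_num)).congr (.of_forall fun v => ?_)
    simp only [jap]
    rw [Real.sqrt_eq_rpow, ← Real.rpow_mul (by positivity)]
    norm_num
  rw [← integrableOn_univ, ← union_compl_self (Metric.closedBall (0 : R3) R)]
  refine (hc.continuousOn.integrableOn_compact (isCompact_closedBall 0 R)).union ?_
  refine Integrable.mono' (hj.const_mul C).integrableOn hc.aestronglyMeasurable ?_
  filter_upwards [ae_restrict_of_ae h,
    ae_restrict_mem (Metric.isClosed_closedBall.measurableSet.compl)] with v hv hvR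
  have hR : R ≤ ‖v‖ := by
    rw [mem_compl_iff, mem_closedBall_zero_iff, not_le] at hvR
    exact hvR.le
  have := (hv hR).2
  rw [Real.norm_eq_abs]
  linarith [norm_nonneg (∇ f v)]

theorem sobolevNorm_lt_top {f : R3 → ℝ} {σ : ℝ} {M : ℕ} (h : weightedSobolevNorm σ M f < ⊤) :
    sobolevNorm σ (fun v => (f v : ℂ)) < ⊤ := by
  have h0 : (0 : Fin 3 → ℕ) ∈ multiIndices M := by simp [multiIndices]
  have := ENNReal.sum_lt_top.1 h 0 h0
  have hm : monomialMul 0 f = fun v => (f v : ℂ) := by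
    funext v
    simp [monomialMul]
  rwa [hm] at this

/-- A nonnegative bounded interaction multiplier satisfies the stability condition. -/
theorem stabilityL_of_hat_nonneg {W f0 : R3 → ℝ} (hcont : Continuous f0) (hpos : ∀ v, 0 < f0 v)
    (hrad : ∀ v w, ‖v‖ = ‖w‖ → f0 v = f0 w)
    (hsob : ∃ δ : ℝ, 0 < δ ∧ weightedSobolevNorm (3 / 2 + δ) 2 f0 < ⊤)
    (hint : Integrable f0) {C : ℝ}
    (hW : ∀ k, (hat W k).im = 0 ∧ 0 ≤ (hat W k).re ∧ (hat W k).re ≤ C) : StabilityL W f0 := by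
  obtain ⟨δ, hδ, hfin⟩ := hsob
  set e : R3 := EuclideanSpace.single 0 1 with he
  have hnorm : ∀ r : ℝ, ‖r • e‖ = |r| := fun r => by simp [he, norm_smul]
  set p : ℝ → ℝ := fun r => f0 (r • e) with hpdef
  have hfp : ∀ v, f0 v = p ‖v‖ := fun v => hrad _ _ (by rw [hnorm, abs_norm])
  have hc : Continuous p := by fun_prop
  have hppos : ∀ r, 0 < p r := fun r => hpos _
  have heven : ∀ r, p (-r) = p r := fun r => hrad _ _ (by rw [hnorm, hnorm, abs_neg])
  have hp : Integrable fun v : R3 => p ‖v‖ := by simpa only [← hfp] using hint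
  have hsob0 : sobolevNorm (3 / 2 + δ) (fun v : R3 => (p ‖v‖ : ℂ)) < ⊤ := by
    simpa only [← hfp] using sobolevNorm_lt_top hfin
  have hp1 := integrable_mul_of_integrable_radial hc heven hp
  have hS := integrable_sineTransform hc heven hp (by linarith) hsob0
  set c : ℝ := (2 * Real.pi) ^ (-(3 / 2) : ℝ) * circleArea with hcdef
  have hcpos : 0 < c := mul_pos (by positivity) circleArea_pos
  obtain ⟨κ, hκ, hgap⟩ := exists_uniform_gap (continuousOn_laplace hS)
    (fun ε hε => exists_norm_laplace_le hS hε)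
    (fun z hz => laplace_sineTransform_avoids_neg hc hppos heven hp1 hS hz) (C * c)
  -- The `+ 1` makes `C0` positive. The minimum with `1` covers `k = 0`, where the dispersion
  -- function vanishes and the distance to `1` is exactly `1`.
  refine ⟨(weightedSobolevNorm (3 / 2 + δ) 2 f0).toReal + 1, min κ 1, 3 / 2 + δ, 2, by positivity,
    by positivity, by linarith, by norm_num, ?_, fun ξ hξ k => ?_⟩
  · rw [ENNReal.le_ofReal_iff_toReal_le hfin.ne (by positivity)]
    linarith
  · by_cases hk : k = 0
    · subst hk
      rw [dispersion, laplaceIntegrand_zero_right]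
      exact ⟨integrableOn_zero, by simp⟩
    · obtain ⟨h1, h2⟩ := dispersion_radial (W := W) hfp hc heven hp hS hξ hk
      refine ⟨h1, (min_le_left _ _).trans ?_⟩
      have hz : (conj ξ / (‖k‖ : ℂ)).re ≤ 0 := by
        rw [Complex.div_ofReal_re, Complex.conj_re]
        exact div_nonpos_of_nonpos_of_nonneg hξ (norm_nonneg k)
      obtain ⟨him, hnn, hle⟩ := hW k
      have := hgap _ hz ((hat W k).re * c) ⟨mul_nonneg hnn hcpos.le, by gcongr⟩
      refine this.trans_eq ?_
      rw [h2, ← norm_neg, hat_eq_ofReal_re him, ← hcdef, Complex.ofReal_re, Complex.ofReal_mul]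
      congr 1
      ring

/-! ### The Fourier transform of the fundamental solution. -/

theorem laplacian_eq_sum_basisFun (φ : R3 → ℝ) (x : R3) :
    Laplacian.laplacian φ x = ∑ i, iteratedFDeriv ℝ 2 φ x
      ![EuclideanSpace.basisFun (Fin 3) ℝ i, EuclideanSpace.basisFun (Fin 3) ℝ i] := by
  rw [InnerProductSpace.laplacian_eq_iteratedFDeriv_orthonormalBasis φ
    (EuclideanSpace.basisFun (Fin 3) ℝ)]

theorem abs_laplacian_le (φ : R3 → ℝ) (x : R3) :
    |Laplacian.laplacian φ x| ≤ 3 * ‖iteratedFDeriv ℝ 2 φ x‖ := by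
  rw [laplacian_eq_sum_basisFun]
  calc |∑ i, iteratedFDeriv ℝ 2 φ x ![EuclideanSpace.basisFun (Fin 3) ℝ i,
        EuclideanSpace.basisFun (Fin 3) ℝ i]| ≤ ∑ _i : Fin 3, ‖iteratedFDeriv ℝ 2 φ x‖ := by
        refine (Finset.abs_sum_le_sum_abs _ _).trans (Finset.sum_le_sum fun i _ => ?_)
        refine ((iteratedFDeriv ℝ 2 φ x).le_opNorm _).trans ?_
        simp [Fin.prod_univ_two]
    _ = 3 * ‖iteratedFDeriv ℝ 2 φ x‖ := by simp

theorem iteratedFDeriv_comp_inner {F : ℝ → ℝ} (hF : ContDiff ℝ ∞ F) (k : R3) (x : R3) (n : ℕ) :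
    iteratedFDeriv ℝ n (fun y => F (inner ℝ k y)) x =
      (iteratedFDeriv ℝ n F (inner ℝ k x)).compContinuousLinearMap fun _ => innerSL ℝ k :=
  (innerSL ℝ k).iteratedFDeriv_comp_right hF x (i := n) (by exact_mod_cast le_top)

theorem laplacian_comp_inner {F : ℝ → ℝ} (hF : ContDiff ℝ ∞ F) (k : R3) (x : R3) :
    Laplacian.laplacian (fun y : R3 => F (inner ℝ k y)) x =
      ‖k‖ ^ 2 * iteratedDeriv 2 F (inner ℝ k x) := by
  rw [laplacian_eq_sum_basisFun, ← OrthonormalBasis.sum_sq_inner_left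
    (EuclideanSpace.basisFun (Fin 3) ℝ) k, Finset.sum_mul]
  refine Finset.sum_congr rfl fun i _ => ?_
  rw [iteratedFDeriv_comp_inner hF]
  simp only [ContinuousMultilinearMap.compContinuousLinearMap_apply, innerSL_apply_apply]
  rw [iteratedFDeriv_apply_eq_iteratedDeriv_mul_prod, Fin.prod_univ_two]
  simp [pow_two]

theorem norm_iteratedFDeriv_comp_inner_le {F : ℝ → ℝ} (hF : ContDiff ℝ ∞ F) (k : R3)
    (hb : ∀ n x, |iteratedDeriv n F x| ≤ 1) (x : R3) (n : ℕ) :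
    ‖iteratedFDeriv ℝ n (fun y => F (inner ℝ k y)) x‖ ≤ ‖k‖ ^ n := by
  rw [iteratedFDeriv_comp_inner hF]
  refine (ContinuousMultilinearMap.norm_compContinuousLinearMap_le _ _).trans ?_
  rw [norm_iteratedFDeriv_eq_norm_iteratedDeriv, Finset.prod_const, innerSL_apply_norm,
    Finset.card_univ, Fintype.card_fin]
  exact mul_le_of_le_one_left (by positivity) (hb n _)

/-- Testing the equation of the fundamental solution against a plane wave. -/
theorem IsFundamentalSolution.integral_mul_comp_inner {F : ℝ → ℝ} (hF : ContDiff ℝ ∞ F) (k : R3)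
    {α : ℝ} {W : R3 → ℝ} (hW : IsFundamentalSolution α W) (hb : ∀ n x, |iteratedDeriv n F x| ≤ 1)
    (h2 : ∀ x, iteratedDeriv 2 F x = -F x) :
    (α + ‖k‖ ^ 2) * ∫ x, W x * F (inner ℝ k x) = F 0 := by
  obtain ⟨hWi, hWeq⟩ := hW
  let χ : ContDiffBump (0 : R3) := ⟨1, 2, one_pos, one_lt_two⟩
  have hχ : ContDiff ℝ ∞ χ := χ.contDiff
  have hbound : ∀ i : ℕ, ∃ B : ℝ, ∀ x, ‖iteratedFDeriv ℝ i χ x‖ ≤ B := fun i =>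
    (χ.hasCompactSupport.iteratedFDeriv i).exists_bound_of_continuous
      (hχ.continuous_iteratedFDeriv (by exact_mod_cast le_top))
  choose B hB using hbound
  -- The plane wave is not compactly supported, so it is cut off by `χ(a n • y)`. As `a n → 0` the
  -- cutoff becomes `1` near every point, while `a n ≤ 1` keeps its derivatives bounded uniformly in
  -- `n`.
  set a : ℕ → ℝ := fun n => ((n : ℝ) + 1)⁻¹ with ha
  have hapos : ∀ n, 0 < a n := fun n => by positivity
  have hale : ∀ n, a n ≤ 1 := fun n => inv_le_one_of_one_le₀ (by simp)
  set ψ : R3 → ℝ := fun y => F (inner ℝ k y) with hψ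
  have hψc : ContDiff ℝ ∞ ψ := hF.comp (contDiff_const.inner ℝ contDiff_id)
  have hχn : ∀ n, ContDiff ℝ ∞ fun y : R3 => χ (a n • y) := fun n =>
    hχ.comp (contDiff_const_smul _)
  set φ : ℕ → R3 → ℝ := fun n y => χ (a n • y) * ψ y with hφ
  have hφc : ∀ n, ContDiff ℝ ∞ (φ n) := fun n => (hχn n).mul hψc
  have hφs : ∀ n, HasCompactSupport (φ n) := fun n =>
    (χ.hasCompactSupport.comp_smul (hapos n).ne').mul_right
  have hone : ∀ (x : R3), ∀ᶠ n in Filter.atTop, φ n =ᶠ[nhds x] ψ := by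
    intro x
    have hlim : Filter.Tendsto (fun n => ‖a n • x‖) Filter.atTop (nhds 0) := by
      have : Filter.Tendsto a Filter.atTop (nhds 0) := by
        simpa [ha] using tendsto_one_div_add_atTop_nhds_zero_nat (𝕜 := ℝ)
      simpa using (this.smul_const x).norm
    filter_upwards [hlim.eventually_lt_const one_pos] with n hn
    have hcont : Continuous fun y : R3 => ‖a n • y‖ := by fun_prop
    filter_upwards [hcont.continuousAt.eventually_lt_const hn] with y hy
    have : χ (a n • y) = 1 := χ.one_of_mem_closedBall (by
      rw [mem_closedBall_zero_iff]
      exact hy.le)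
    simp only [hφ, this, one_mul]
  have htwo : ((2 : ℕ) : WithTop ℕ∞) ≤ ((⊤ : ℕ∞) : WithTop ℕ∞) :=
    WithTop.coe_le_coe.2 (le_top : ((2 : ℕ) : ℕ∞) ≤ ⊤)
  have hFle : ∀ x, |F x| ≤ 1 := fun x => by simpa using hb 0 x
  -- The Leibniz bound for the second derivative of cutoff times wave; the factor `3` is the number
  -- of terms in the Laplacian.
  set K : ℝ := 3 * ∑ i ∈ Finset.range 3, ((2).choose i : ℝ) * B i * ‖k‖ ^ (2 - i) with hK
  have hlap : ∀ n x, |Laplacian.laplacian (φ n) x| ≤ K := by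
    intro n x
    refine (abs_laplacian_le _ _).trans ?_
    refine mul_le_mul_of_nonneg_left ?_ (by norm_num)
    refine (norm_iteratedFDeriv_mul_le (hχn n) hψc x (n := 2) htwo).trans ?_
    refine Finset.sum_le_sum fun i _ => ?_
    have hB0 : 0 ≤ B i := (norm_nonneg _).trans (hB i 0)
    gcongr
    · rw [iteratedFDeriv_comp_const_smul _ (hχ.of_le (by exact_mod_cast le_top)), norm_smul,
        Real.norm_of_nonneg (by have := hapos n; positivity)]
      exact (mul_le_of_le_one_left (norm_nonneg _) (pow_le_one₀ (hapos n).le (hale n))).trans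
        (hB i _)
    · exact norm_iteratedFDeriv_comp_inner_le hF k hb x _
  have hφle : ∀ n x, |φ n x| ≤ 1 := fun n x => by
    rw [hφ, abs_mul, abs_of_nonneg (χ.nonneg' _)]
    exact mul_le_one₀ χ.le_one (abs_nonneg _) (hFle _)
  have hlapcont : ∀ n, Continuous (Laplacian.laplacian (φ n)) := by
    intro n
    have : Continuous fun x => iteratedFDeriv ℝ 2 (φ n) x :=
      (hφc n).continuous_iteratedFDeriv htwo
    have heq : Laplacian.laplacian (φ n) = fun x => ∑ i, iteratedFDeriv ℝ 2 (φ n) x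
      ![EuclideanSpace.basisFun (Fin 3) ℝ i, EuclideanSpace.basisFun (Fin 3) ℝ i] :=
      funext fun x => laplacian_eq_sum_basisFun _ _
    rw [heq]
    fun_prop
  -- The limit integrand uses `-Δψ = |k|² ψ`, a consequence of `F'' = -F`. The integrals themselves
  -- are eventually constant, equal to `F 0`.
  have htend := tendsto_integral_of_dominated_convergence
    (F := fun n x => W x * (-(Laplacian.laplacian (φ n) x) + α * φ n x))
    (f := fun x => W x * ((α + ‖k‖ ^ 2) * ψ x)) (μ := volume)
    (fun x => |W x| * (K + |α|)) ?_ (hWi.abs.mul_const _) ?_ ?_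
  · have hconst : ∀ᶠ n in Filter.atTop,
        ∫ x, W x * (-(Laplacian.laplacian (φ n) x) + α * φ n x) = F 0 := by
      filter_upwards [hone 0] with n hn
      rw [hWeq (φ n) (hφc n) (hφs n), hn.self_of_nhds]
      simp [hψ]
    have := tendsto_nhds_unique (htend.congr' hconst) tendsto_const_nhds
    rw [← this, ← integral_const_mul]
    refine integral_congr_ae (.of_forall fun x => ?_)
    simp only [hψ]
    ring
  · exact fun n => hWi.aestronglyMeasurable.mul
      (((hlapcont n).neg.add (continuous_const.mul (hφc n).continuous)).aestronglyMeasurable)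
  · refine fun n => .of_forall fun x => ?_
    rw [Real.norm_eq_abs, abs_mul]
    gcongr
    refine (abs_add_le _ _).trans ?_
    rw [abs_neg, abs_mul]
    exact add_le_add (hlap n x) (mul_le_of_le_one_right (abs_nonneg _) (hφle n x))
  · refine .of_forall fun x => tendsto_const_nhds.congr' ?_
    filter_upwards [hone x] with n hn
    rw [(InnerProductSpace.laplacian_congr_nhds hn).self_of_nhds, hn.self_of_nhds,
      laplacian_comp_inner hF, h2]
    simp only [hψ]
    ring

/-- The Fourier transform of the fundamental solution of `-Δ + α`. -/
theorem IsFundamentalSolution.hat_eq {α : ℝ} (hα : 0 < α) {W : R3 → ℝ}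
    (hW : IsFundamentalSolution α W) (k : R3) :
    hat W k = (((2 * Real.pi) ^ (-(3 / 2) : ℝ) * (1 / (α + ‖k‖ ^ 2)) : ℝ) : ℂ) := by
  have hpos : 0 < α + ‖k‖ ^ 2 := by positivity
  -- The cosine gives the real part of the transform; the sine, which vanishes at the origin, gives
  -- a zero imaginary part.
  have hcos := IsFundamentalSolution.integral_mul_comp_inner Real.contDiff_cos k hW Real.abs_iteratedDeriv_cos_le_one
    (fun x => by simp)
  have hsin := IsFundamentalSolution.integral_mul_comp_inner Real.contDiff_sin k hW Real.abs_iteratedDeriv_sin_le_one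
    (fun x => by simp)
  rw [Real.cos_zero, mul_comm, ← eq_div_iff hpos.ne'] at hcos
  rw [Real.sin_zero, mul_eq_zero, or_iff_right hpos.ne'] at hsin
  have hic : Integrable fun x => W x * Real.cos (inner ℝ k x) :=
    hW.1.mul_bdd (c := 1) (by fun_prop) (.of_forall fun x => Real.abs_cos_le_one _)
  have his : Integrable fun x => W x * Real.sin (inner ℝ k x) :=
    hW.1.mul_bdd (c := 1) (by fun_prop) (.of_forall fun x => Real.abs_sin_le_one _)
  have hsplit : ∀ v : R3, Complex.exp (-(Complex.I * ((inner ℝ v k : ℝ) : ℂ))) * ((W v : ℝ) : ℂ) =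
      ((W v * Real.cos (inner ℝ k v) : ℝ) : ℂ) -
        Complex.I * ((W v * Real.sin (inner ℝ k v) : ℝ) : ℂ) := fun v => by
    have e1 : -(Complex.I * ((inner ℝ v k : ℝ) : ℂ)) =
        (-(inner ℝ k v : ℝ) : ℂ) * Complex.I := by
      rw [real_inner_comm]; ring
    rw [e1, Complex.exp_mul_I, Complex.cos_neg, Complex.sin_neg]
    push_cast; ring
  have hicc : Integrable fun x => ((W x * Real.cos (inner ℝ k x) : ℝ) : ℂ) := hic.ofReal
  have hisc : Integrable fun x => ((W x * Real.sin (inner ℝ k x) : ℝ) : ℂ) := his.ofReal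
  rw [hat]
  simp_rw [hsplit]
  rw [integral_sub hicc (hisc.const_mul _), integral_const_mul, integral_complex_ofReal,
    integral_complex_ofReal, hcos, hsin]
  push_cast; ring

end LandauDamping

/-! ### The three classes of interactions. -/

theorem mainTheorem5
    (f0 : LandauDamping.R3 → ℝ)
    (hcont : Continuous f0)
    (hpos : ∀ v, 0 < f0 v)
    (hrad : ∀ v w, ‖v‖ = ‖w‖ → f0 v = f0 w)
    (hsob : ∃ δ : ℝ, 0 < δ ∧ LandauDamping.weightedSobolevNorm (3 / 2 + δ) 2 f0 < ⊤)
    (hdecay : LandauDamping.DecaysWithGradient f0) :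
    (∀ α : ℝ, 0 < α → ∀ W : LandauDamping.R3 → ℝ, MeasureTheory.Integrable W →
      (∀ k, LandauDamping.hat W k = ((1 / (α + ‖k‖ ^ 2) : ℝ) : ℂ)) →
        LandauDamping.StabilityL W f0) ∧
    (∀ α : ℝ, 0 < α → ∀ W : LandauDamping.R3 → ℝ, LandauDamping.IsFundamentalSolution α W →
      LandauDamping.StabilityL W f0) ∧
    (∀ W : LandauDamping.R3 → ℝ, MeasureTheory.Integrable W → LandauDamping.NonnegScreened W →
      LandauDamping.StabilityL W f0) := by
  -- Decay of `f0` enters through its integrability; each class then needs only a bound on `Ŵ`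
  -- uniform in `k`.
  have key := fun (W : LandauDamping.R3 → ℝ) (C : ℝ) =>
    LandauDamping.stabilityL_of_hat_nonneg (W := W) (C := C) hcont hpos hrad hsob
      (LandauDamping.integrable_of_decaysWithGradient hcont hdecay)
  have hle : ∀ α : ℝ, 0 < α → ∀ k : LandauDamping.R3, 1 / (α + ‖k‖ ^ 2) ≤ 1 / α :=
    fun α hα k => one_div_le_one_div_of_le hα (by nlinarith [sq_nonneg ‖k‖])
  refine ⟨fun α hα W _ hW => ?_, fun α hα W hW => ?_, fun W _ hW => ?_⟩
  · refine key W (1 / α) fun k => ?_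
    rw [hW k, Complex.ofReal_im, Complex.ofReal_re]
    exact ⟨rfl, by positivity, hle α hα k⟩
  · refine key W ((2 * Real.pi) ^ (-(3 / 2) : ℝ) * (1 / α)) fun k => ?_
    rw [hW.hat_eq hα k, Complex.ofReal_im, Complex.ofReal_re]
    exact ⟨rfl, by positivity, mul_le_mul_of_nonneg_left (hle α hα k) (by positivity)⟩
  · obtain ⟨C, hC⟩ := hW
    refine key W |C| fun k => ⟨(hC k).1, (hC k).2.1, (hC k).2.2.trans ?_⟩
    have hjap : LandauDamping.jap k ^ (-2 : ℝ) ≤ 1 :=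
      Real.rpow_le_one_of_one_le_of_nonpos
        (Real.one_le_sqrt.2 (by nlinarith [sq_nonneg ‖k‖])) (by norm_num)
    have hjap0 : 0 ≤ LandauDamping.jap k ^ (-2 : ℝ) := Real.rpow_nonneg (Real.sqrt_nonneg _) _
    calc C * LandauDamping.jap k ^ (-2 : ℝ) ≤ |C| * LandauDamping.jap k ^ (-2 : ℝ) :=
          mul_le_mul_of_nonneg_right (le_abs_self C) hjap0
      _ ≤ |C| := mul_le_of_le_one_right (abs_nonneg C) hjap
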